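/- There is a universal constant $C<\infty$ such that the following holds. Let $P$ be a probability measure on a measurable space $(\mathcal X,\mathcal A)$, let $n\ge 1$, let $X_1,\dots,X_n$ be the coordinate projections on the product probability space $(\mathcal X^n,\mathcal A^n,P^n)$, and set $\mathbb G_nf=n^{-1/2}\sum_{i=1}^n\bigl(f(X_i)-Pf\bigr)$ and $\|\mathbb G_n\|_{\mathcal F}=\sup_{f\in\mathcal F}|\mathbb G_nf|$, where $Pf=\int f\,dP$; write $\mathrm E^*_P$ for outer expectation under $P^n$, and $\|f\|_{Q,r}$ for the norm of $f$ in $L_r(Q)$. Call a class $\mathcal G$ of functions $P$-measurable if, for every $m$ and every $e_1,\dots,e_m\in\{-1,1\}$, the map $(x_1,\dots,x_m)\mapsto\sup_{g\in\mathcal G}\bigl|\sum_{i=1}^m e_ig(x_i)\bigr|$ is measurable on the completion of $(\mathcal X^m,\mathcal A^m,P^m)$. Let $\mathcal F$ be a class of measurable functions $f:\mathcal X\to\mathbb R$ with envelope function $F$, i.e. $F:\mathcal X\to\mathbb R$ is measurable and $|f|\le F$ for every $f\in\mathcal F$. Suppose that $\mathcal F$, $\mathcal F^2=\{f^2:f\in\mathcal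 F\}$ and $\mathcal F^4=\{f^4:f\in\mathcal F\}$ are $P$-measurable and that $PF^{(4p-2)/(p-1)}<\infty$ for some $p>1$. Let $$J(\delta)=\sup_Q\int_0^\delta\sqrt{1+\log N\bigl(\varepsilon\|F\|_{Q,2},\mathcal F,L_2(Q)\bigr)}\,d\varepsilon\in[0,\infty]$$ be the uniform entropy integral, where the supremum is over all finitely discrete probability distributions $Q$ on $\mathcal X$ and $N(\varepsilon,\mathcal F,L_2(Q))$ is the minimal number of balls of radius $\varepsilon$ in $L_2(Q)$ needed to cover $\mathcal F$. If $\delta\in(0,1)$ and $Pf^2<\delta^2PF^2$ for every $f\in\mathcal F$, then $$\mathrm E_P^*\|\mathbb G_n\|_{\mathcal F}\le C\,J(\delta)\Bigl(1+\frac{J(\delta^{1/p})}{\delta^2\sqrt n}\,\frac{\|F\|_{P,(4p-2)/(p-1)}^{2-1/p}}{\|F\|_{P,2}^{2-1/p}}\Bigr)^{p/(2p-1)}\|F\|_{P,2}.$$ -/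

import Mathlib

open MeasureTheory Set
open scoped ENNReal NNReal

universe u

noncomputable section

namespace EmpProc

variable {X : Type*} [MeasurableSpace X]

/-- The outer expectation `E* T = inf {E U : U ≥ T, U measurable}` of a nonnegative, extended-real
valued, not necessarily measurable map `T`. -/
def outerExpectation {Ω : Type*} [MeasurableSpace Ω] (μ : Measure Ω) (T : Ω → ℝ≥0∞) : ℝ≥0∞ :=
  ⨅ (U : Ω → ℝ≥0∞) (_ : Measurable U) (_ : ∀ ω, T ω ≤ U ω), ∫⁻ ω, U ω ∂μ

/-- The empirical process `𝔾_n f = n^{-1/2} ∑_i (f(X_i) - P f)` at the sample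
`x = (X_1, …, X_n)`. -/
def empProc (P : Measure X) {n : ℕ} (x : Fin n → X) (f : X → ℝ) : ℝ :=
  (Real.sqrt n)⁻¹ * ∑ i, (f (x i) - ∫ y, f y ∂P)

/-- The supremum `‖𝔾_n‖_𝓕 = sup_{f ∈ 𝓕} |𝔾_n f|`, as an extended nonnegative number. -/
def empiricalSup (P : Measure X) {n : ℕ} (𝓕 : Set (X → ℝ)) (x : Fin n → X) : ℝ≥0∞ :=
  ⨆ f ∈ 𝓕, ENNReal.ofReal |empProc P x f|

/-- `P`-measurability of a class of functions: for every `n` and all signs `e_1, …, e_n`, the map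
`(X_1, …, X_n) ↦ sup_{f ∈ 𝓕} |∑_i e_i f(X_i)|` is measurable with respect to the completion
of the product probability space `(Xⁿ, 𝒜ⁿ, Pⁿ)`. -/
def PMeasurable (P : Measure X) (𝓕 : Set (X → ℝ)) : Prop :=
  ∀ (n : ℕ) (e : Fin n → ℝ), (∀ i, e i = 1 ∨ e i = -1) →
    NullMeasurable (fun x : Fin n → X => ⨆ f ∈ 𝓕, ENNReal.ofReal |∑ i, e i * f (x i)|)
      (Measure.pi fun _ => P)

/-- `F` is an envelope function of the class `𝓕`. -/
def IsEnvelope (F : X → ℝ) (𝓕 : Set (X → ℝ)) : Prop :=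
  Measurable F ∧ ∀ f ∈ 𝓕, ∀ x, |f x| ≤ F x

/-- The class `{f ^ k : f ∈ 𝓕}` of pointwise powers. -/
def powClass (𝓕 : Set (X → ℝ)) (k : ℕ) : Set (X → ℝ) :=
  (fun f : X → ℝ => fun x => f x ^ k) '' 𝓕

/-- Finitely discrete probability distributions: probability measures that are finite
combinations of point masses. -/
def IsFinitelyDiscreteProbability (Q : Measure X) : Prop :=
  IsProbabilityMeasure Q ∧
    ∃ (s : Finset X) (w : X → ℝ≥0), Q = ∑ x ∈ s, w x • Measure.dirac x

/-- The covering number `N(ε, 𝓕, L_r(Q))`: the minimal number of (closed) balls of radius `ε`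
in `L_r(Q)`, with arbitrary centres in `L_r(Q)`, that cover (the classes of) the functions
in `𝓕`. -/
def coveringNumber (ε : ℝ≥0) (𝓕 : Set (X → ℝ)) (r : ℝ≥0∞) [Fact (1 ≤ r)] (Q : Measure X) : ℕ∞ :=
  Metric.externalCoveringNumber ε {g : Lp ℝ r Q | ∃ f ∈ 𝓕, g =ᵐ[Q] f}

/-- `√(1 + log N)` for an extended natural number `N`, with value `∞` at `N = ∞`. -/
def sqrtOneAddLog (N : ℕ∞) : ℝ≥0∞ :=
  (1 + (ENNReal.log (N : ℝ≥0∞)).toENNReal) ^ (1 / 2 : ℝ)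

/-- The uniform entropy integral
`J(δ, 𝓕 | F, L_r) = sup_Q ∫_0^δ √(1 + log N(ε ‖F‖_{Q,r}, 𝓕, L_r(Q))) dε`,
the supremum being over all finitely discrete probability distributions `Q`.
It may be infinite. -/
def uniformEntropyIntegral (δ : ℝ) (𝓕 : Set (X → ℝ)) (F : X → ℝ) (r : ℝ≥0∞) [Fact (1 ≤ r)] :
    ℝ≥0∞ :=
  ⨆ (Q : Measure X) (_ : IsFinitelyDiscreteProbability Q),
    ∫⁻ ε in Ioc (0 : ℝ) δ,
      sqrtOneAddLog (coveringNumber (ε.toNNReal * (eLpNorm F r Q).toNNReal) 𝓕 r Q)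

end EmpProc

end

/-! Symmetrization reduces the problem to Rademacher sums Σ e_i f(X_i). Given the sample these are
sub-Gaussian for the Euclidean distance between the vectors (f(X_i)), so chaining
(`sum_iSup_signSum_le`) bounds their supremum by an entropy integral up to the random radius (sup_f
Σ f(X_i)²)^{1/2}. The integrand is nonincreasing, so J(s) ≤ (1 + s/t) J(t)
(`uniformEntropyIntegral_le`); this trades the random radius for a fixed t, after which Jensen's
inequality takes the mean inside. What remains is to control S = E sup_f Σ f(X_i)².

With D = n‖F‖²_{P,2}, the variance hypothesis gives S ≤ δ²D + √n E*‖G_n‖ over the squares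
(`lintegral_supSumSq_le`). The squares are chained in the same way
(`rademacherSup_powClass_two_le`), with two changes. Since |f² - g²| ≤ 2F|f - g| when |f|, |g| ≤ F,
they are covered by covering 𝓕 in L₂ of the measure that weights X_i proportionally to F(X_i)².
Their radius is bounded by Hölder: Σ f⁴ ≤ (Σ f²)^{1/p} (Σ F^R)^{1-1/p}, R = (4p-2)/(p-1).

Thus S is bounded in terms of itself. For t = max(δ, √(S/D)) and Y = t/δ this reads Y² ≤ 1 + 144
Y^{1/p} Z, where Z is the term added to 1 in the theorem. As 1/p < 2, it solves to Y ≤ 144 (1 +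
Z)^{p/(2p-1)} (`le_of_sq_le_add_rpow`), and the bound for 𝓕 itself at t is 96 Y J(δ) ‖F‖_{P,2}. -/

noncomputable section

namespace EmpProc

/-! ### Rademacher sums over finite sets -/

/-- The Rademacher sign encoded by a Boolean. -/
def sign (b : Bool) : ℝ := if b then 1 else -1

lemma sign_eq (b : Bool) : sign b = 1 ∨ sign b = -1 := by cases b <;> simp [sign]

lemma abs_sign (b : Bool) : |sign b| = 1 := by cases b <;> simp [sign]

/-- The Rademacher sum `∑ i, e i * t i`. -/
def signSum {n : ℕ} (e : Fin n → Bool) (t : Fin n → ℝ) : ℝ := ∑ i, sign (e i) * t i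

lemma signSum_sub {n : ℕ} (e : Fin n → Bool) (s t : Fin n → ℝ) :
    signSum e (s - t) = signSum e s - signSum e t := by
  simp [signSum, mul_sub, Finset.sum_sub_distrib]

lemma abs_signSum_le {n : ℕ} (e : Fin n → Bool) (t : EuclideanSpace ℝ (Fin n)) :
    |signSum e t| ≤ n * ‖t‖ := by
  calc |signSum e t| ≤ ∑ i, |sign (e i) * t i| := Finset.abs_sum_le_sum_abs _ _
    _ ≤ ∑ _i : Fin n, ‖t‖ := by
        refine Finset.sum_le_sum fun i _ => ?_
        rw [abs_mul, abs_sign, one_mul]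
        exact PiLp.norm_apply_le t i
    _ = n * ‖t‖ := by simp

/-- Rademacher sums are sub-Gaussian. -/
lemma sum_exp_signSum_le {n : ℕ} (t : EuclideanSpace ℝ (Fin n)) (l : ℝ) :
    ∑ e : Fin n → Bool, Real.exp (l * signSum e t) ≤ 2 ^ n * Real.exp (l ^ 2 * ‖t‖ ^ 2 / 2) := by
  have h1 : ∀ e : Fin n → Bool, Real.exp (l * signSum e t)
      = ∏ i, Real.exp (l * (sign (e i) * t i)) := by
    intro e
    rw [signSum, Finset.mul_sum, Real.exp_sum]
  simp_rw [h1]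
  have h2 := Finset.prod_univ_sum (fun _ : Fin n => (Finset.univ : Finset Bool))
    (fun i b => Real.exp (l * (sign b * t i)))
  rw [Fintype.piFinset_univ] at h2
  rw [← h2]
  have h3 : ∀ i, ∑ b : Bool, Real.exp (l * (sign b * t i)) ≤ 2 * Real.exp ((l * t i) ^ 2 / 2) := by
    intro i
    have := Real.cosh_le_exp_half_sq (l * t i)
    rw [Real.cosh_eq] at this
    simp only [Fintype.sum_bool, sign, if_true, one_mul]
    simp only [Bool.false_eq_true, if_false, neg_one_mul, mul_neg]
    linarith
  calc ∏ i, ∑ b : Bool, Real.exp (l * (sign b * t i))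
      ≤ ∏ i : Fin n, (2 * Real.exp ((l * t i) ^ 2 / 2)) :=
        Finset.prod_le_prod (fun i _ => Finset.sum_nonneg fun _ _ => (Real.exp_pos _).le)
          fun i _ => h3 i
    _ = 2 ^ n * Real.exp (l ^ 2 * ‖t‖ ^ 2 / 2) := by
        rw [Finset.prod_mul_distrib, ← Real.exp_sum]
        simp only [Finset.prod_const, Finset.card_univ, Fintype.card_fin]
        congr 2
        rw [EuclideanSpace.real_norm_sq_eq, Finset.mul_sum, Finset.sum_div]
        exact Finset.sum_congr rfl fun i _ => by ring

/-- Maximal inequality for Rademacher sums over a finite set of vectors. -/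
lemma sum_max_signSum_le {n : ℕ} (D : Finset (EuclideanSpace ℝ (Fin n))) (ρ H : ℝ)
    (hρ : 0 < ρ) (hH : 0 < H) (hD : ∀ t ∈ D, ‖t‖ ≤ ρ) (hcard : Real.log (2 * D.card) ≤ 2 * H ^ 2)
    (m : (Fin n → Bool) → ℝ) (hm : ∀ e, ∃ t ∈ D, m e ≤ |signSum e t|) :
    ∑ e, m e ≤ 2 ^ n * (2 * ρ * H) := by
  have hDpos : (0 : ℝ) < D.card := by
    obtain ⟨t, ht, -⟩ := hm (fun _ => true)
    exact_mod_cast Finset.card_pos.2 ⟨t, ht⟩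
  -- This l minimizes 2H²/l + lρ²/2, with minimum 2ρH.
  set l : ℝ := 2 * H / ρ with hl
  have hlpos : 0 < l := by positivity
  set L : ℝ := Real.log (2 * D.card) + l ^ 2 * ρ ^ 2 / 2 with hL
  -- The tangent line of exp at L takes the place of Jensen's inequality for the logarithm.
  have h1 : ∀ e, l * m e ≤ L - 1 + Real.exp (l * m e) * Real.exp (-L) := by
    intro e
    rw [← Real.exp_add]
    have := Real.add_one_le_exp (l * m e + -L)
    linarith
  have h2 : ∀ e, Real.exp (l * m e) ≤
      ∑ t ∈ D, (Real.exp (l * signSum e t) + Real.exp (-l * signSum e t)) := by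
    intro e
    obtain ⟨t, ht, hmt⟩ := hm e
    have h3 : Real.exp (l * m e) ≤ Real.exp (l * signSum e t) + Real.exp (-l * signSum e t) := by
      have h4 : Real.exp (l * m e) ≤ Real.exp (l * |signSum e t|) :=
        Real.exp_le_exp.2 (by gcongr)
      rcases abs_cases (signSum e t) with ⟨h, _⟩ | ⟨h, _⟩
      · rw [h] at h4
        linarith [Real.exp_pos (-l * signSum e t)]
      · rw [h, mul_neg, ← neg_mul] at h4
        linarith [Real.exp_pos (l * signSum e t)]
    exact h3.trans (Finset.single_le_sum
      (f := fun t : EuclideanSpace ℝ (Fin n) =>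
        Real.exp (l * signSum e t) + Real.exp (-l * signSum e t))
      (fun t _ => by positivity) ht)
  have h3 : ∑ e, Real.exp (l * m e) ≤ 2 ^ n * Real.exp L := by
    calc ∑ e, Real.exp (l * m e)
        ≤ ∑ e, ∑ t ∈ D, (Real.exp (l * signSum e t) + Real.exp (-l * signSum e t)) :=
          Finset.sum_le_sum fun e _ => h2 e
      _ = ∑ t ∈ D, ∑ e, (Real.exp (l * signSum e t) + Real.exp (-l * signSum e t)) :=
          Finset.sum_comm
      _ ≤ ∑ _t ∈ D, 2 * (2 ^ n * Real.exp (l ^ 2 * ρ ^ 2 / 2)) := by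
          refine Finset.sum_le_sum fun t ht => ?_
          rw [Finset.sum_add_distrib]
          have h4 := sum_exp_signSum_le t l
          have h5 := sum_exp_signSum_le t (-l)
          rw [neg_sq] at h5
          have h6 : Real.exp (l ^ 2 * ‖t‖ ^ 2 / 2) ≤ Real.exp (l ^ 2 * ρ ^ 2 / 2) := by
            have := hD t ht
            gcongr
          have h7 : (2 : ℝ) ^ n * Real.exp (l ^ 2 * ‖t‖ ^ 2 / 2) ≤
            2 ^ n * Real.exp (l ^ 2 * ρ ^ 2 / 2) := by gcongr
          linarith
      _ = 2 ^ n * Real.exp L := by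
          rw [hL, Real.exp_add, Real.exp_log (by positivity), Finset.sum_const, nsmul_eq_mul]
          ring
  have h4 : l * ∑ e, m e ≤ 2 ^ n * L := by
    calc l * ∑ e, m e = ∑ e, l * m e := Finset.mul_sum _ _ _
      _ ≤ ∑ e, (L - 1 + Real.exp (l * m e) * Real.exp (-L)) := Finset.sum_le_sum fun e _ => h1 e
      _ = 2 ^ n * (L - 1) + (∑ e, Real.exp (l * m e)) * Real.exp (-L) := by
          rw [Finset.sum_add_distrib, Finset.sum_mul]; simp; ring
      _ ≤ 2 ^ n * (L - 1) + (2 ^ n * Real.exp L) * Real.exp (-L) := by gcongr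
      _ = 2 ^ n * L := by
          rw [mul_assoc, ← Real.exp_add, add_neg_cancel, Real.exp_zero]; ring
  have h5 : L ≤ l * (2 * ρ * H) := by
    have : l * ρ = 2 * H := by rw [hl]; field_simp
    have h6 : l ^ 2 * ρ ^ 2 = (2 * H) ^ 2 := by rw [← this]; ring
    have h7 : l * (2 * ρ * H) = 2 * (2 * H) * H := by rw [← this]; ring
    rw [hL, h6, h7]
    nlinarith
  have h6 : l * ∑ e, m e ≤ l * (2 ^ n * (2 * ρ * H)) := by
    calc l * ∑ e, m e ≤ 2 ^ n * L := h4
      _ ≤ 2 ^ n * (l * (2 * ρ * H)) := by gcongr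
      _ = _ := by ring
  exact le_of_mul_le_mul_left h6 hlpos

/-! ### Chaining -/

lemma sqrtOneAddLog_mono : Monotone sqrtOneAddLog := by
  intro a b hab
  unfold sqrtOneAddLog
  gcongr
  exact EReal.toENNReal_le_toENNReal (ENNReal.log_monotone (by gcongr))

lemma sqrtOneAddLog_top : sqrtOneAddLog ⊤ = ⊤ := by
  simp [sqrtOneAddLog]

lemma sqrtOneAddLog_natCast {N : ℕ} (hN : N ≠ 0) :
    sqrtOneAddLog (N : ℕ∞) = ENNReal.ofReal (Real.sqrt (1 + Real.log N)) := by
  have h : (0 : ℝ) < N := by positivity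
  have hlog : 0 ≤ Real.log N := Real.log_natCast_nonneg N
  unfold sqrtOneAddLog
  have : ((N : ℕ∞) : ℝ≥0∞) = ENNReal.ofReal (N : ℝ) := by simp
  rw [this, ENNReal.log_ofReal_of_pos h, EReal.toENNReal_of_ne_top (EReal.coe_ne_top _),
    EReal.toReal_coe, Real.sqrt_eq_rpow,
    ← ENNReal.ofReal_one, ← ENNReal.ofReal_add zero_le_one hlog,
    ENNReal.ofReal_rpow_of_nonneg (by positivity) (by norm_num)]

/-- A dyadic lower sum of a nonincreasing function is at most twice its integral. -/
lemma sum_dyadic_le_lintegral (G : ℝ → ℝ≥0∞) (hG : ∀ u v, 0 < u → u ≤ v → G v ≤ G u) {s : ℝ}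
    (hs : 0 < s) (K : ℕ) :
    ∑ k ∈ Finset.range K, ENNReal.ofReal (s / 2 ^ (k + 1)) * G (s / 2 ^ (k + 1)) ≤
      2 * ∫⁻ u in Ioc 0 s, G u := by
  have key : ∑ k ∈ Finset.range K, ENNReal.ofReal (s / 2 ^ (k + 1)) * G (s / 2 ^ (k + 1)) ≤
      2 * ∫⁻ u in Ioc (s / 2 ^ (K + 1)) s, G u := by
    induction K with
    | zero => simp
    | succ K ih =>
      rw [Finset.sum_range_succ]
      have hle : s / 2 ^ (K + 1 + 1) ≤ s / 2 ^ (K + 1) := by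
        gcongr <;> norm_num
      have hle' : s / 2 ^ (K + 1) ≤ s := div_le_self hs.le (one_le_pow₀ (by norm_num))
      rw [← Ioc_union_Ioc_eq_Ioc hle hle',
        lintegral_union measurableSet_Ioc (Set.Ioc_disjoint_Ioc_of_le le_rfl), mul_add, add_comm]
      refine add_le_add ?_ ih
      have h1 : ∫⁻ _u in Ioc (s / 2 ^ (K + 1 + 1)) (s / 2 ^ (K + 1)), G (s / 2 ^ (K + 1)) ≤
          ∫⁻ u in Ioc (s / 2 ^ (K + 1 + 1)) (s / 2 ^ (K + 1)), G u := by
        refine setLIntegral_mono' measurableSet_Ioc fun u hu => ?_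
        exact hG _ _ ((by positivity : (0 : ℝ) < s / 2 ^ (K + 1 + 1)).trans hu.1) hu.2
      rw [setLIntegral_const, Real.volume_Ioc] at h1
      refine le_trans (le_of_eq ?_) (mul_le_mul_right h1 2)
      -- The factor 2: each dyadic point is twice the length of the dyadic interval ending there,
      -- and G is at least its right-end value on that interval.
      have h2 : s / 2 ^ (K + 1) = 2 * (s / 2 ^ (K + 1) - s / 2 ^ (K + 1 + 1)) := by
        rw [pow_succ _ (K + 1)]; field_simp; ring
      conv_lhs => rw [h2]
      rw [ENNReal.ofReal_mul (by norm_num), ENNReal.ofReal_ofNat, ← h2]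
      ring
  refine key.trans (mul_le_mul_right (lintegral_mono_set ?_) 2)
  exact Ioc_subset_Ioc_left (by positivity)

/-- The chaining bound along the first `K` dyadic scales. -/
lemma sum_iSup_signSum_le_add {n : ℕ} (T : Set (EuclideanSpace ℝ (Fin n))) {a s : ℝ} (ha : 0 < a)
    (hs : 0 < s) (hne : T.Nonempty) (hT : ∀ t ∈ T, ‖t‖ ≤ a * s) (M : ℕ → ℕ) (hM : Monotone M)
    (C : ℕ → Finset (EuclideanSpace ℝ (Fin n))) (hCM : ∀ k, (C k).card ≤ M k)
    (hC : ∀ k, ∀ t ∈ T, ∃ c ∈ C k, ‖t - c‖ ≤ a * (s / 2 ^ k)) (K : ℕ) :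
    ∑ e, ⨆ t ∈ T, ENNReal.ofReal |signSum e t| ≤
      ENNReal.ofReal (∑ k ∈ Finset.range K, 2 ^ n * (6 * a * (s / 2 ^ (k + 1)) *
          Real.sqrt (1 + Real.log (M (k + 1)))) + 2 ^ n * (n * (a * (s / 2 ^ K)))) := by
  classical
  have hMpos : ∀ k, 1 ≤ M k := by
    intro k
    obtain ⟨t, ht⟩ := hne
    obtain ⟨c, hc, -⟩ := hC k t ht
    exact (Finset.card_pos.2 ⟨c, hc⟩).trans_le (hCM k)
  -- the chain of approximations
  have hq : ∀ k, ∃ q : EuclideanSpace ℝ (Fin n) → EuclideanSpace ℝ (Fin n),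
      ∃ C' : Finset (EuclideanSpace ℝ (Fin n)), C'.card ≤ M k ∧ (k = 0 → ∀ t, q t = 0) ∧
      ∀ t ∈ T, q t ∈ C' ∧ ‖t - q t‖ ≤ a * (s / 2 ^ k) := by
    intro k
    -- At scale 0 the single centre 0 suffices, because T lies in the ball of radius a * s; the
    -- chain therefore starts at 0 with no initial term.
    rcases Nat.eq_zero_or_pos k with rfl | hk
    · refine ⟨fun _ => 0, {0}, by simpa using hMpos 0, fun _ _ => rfl, fun t ht => ⟨by simp, ?_⟩⟩
      simpa using hT t ht
    · choose! q hq1 hq2 using hC k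
      exact ⟨q, C k, hCM k, fun h => absurd h hk.ne', fun t ht => ⟨hq1 t ht, hq2 t ht⟩⟩
  choose q C' hcard hq0 hqC using hq
  -- Possible links of the chain. Actual links have norm at most r + 2r, where r is the finer
  -- radius; the filter discards the pairs of centres that are too far apart.
  let D : ℕ → Finset (EuclideanSpace ℝ (Fin n)) := fun k =>
    ((C' (k + 1) ×ˢ C' k).image fun p => p.1 - p.2).filter
      fun d => ‖d‖ ≤ 3 * (a * (s / 2 ^ (k + 1)))
  have hqD : ∀ k, ∀ t ∈ T, q (k + 1) t - q k t ∈ D k := by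
    intro k t ht
    refine Finset.mem_filter.2 ⟨Finset.mem_image.2 ⟨(q (k + 1) t, q k t),
      Finset.mem_product.2 ⟨(hqC (k + 1) t ht).1, (hqC k t ht).1⟩, rfl⟩, ?_⟩
    have h1 := (hqC (k + 1) t ht).2
    have h2 := (hqC k t ht).2
    have h3 : q (k + 1) t - q k t = (t - q k t) - (t - q (k + 1) t) := by abel
    have h4 : a * (s / 2 ^ k) = 2 * (a * (s / 2 ^ (k + 1))) := by rw [pow_succ]; field_simp
    rw [h3]
    refine (norm_sub_le _ _).trans ?_
    linarith
  have hDne : ∀ k, (D k).Nonempty := fun k => by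
    obtain ⟨t, ht⟩ := hne
    exact ⟨_, hqD k t ht⟩
  have hDcard : ∀ k, Real.log (2 * (D k).card) ≤
      2 * Real.sqrt (1 + Real.log (M (k + 1))) ^ 2 := by
    intro k
    have h1 : (D k).card ≤ M (k + 1) * M (k + 1) := by
      refine (Finset.card_filter_le _ _).trans (Finset.card_image_le.trans ?_)
      rw [Finset.card_product]
      exact Nat.mul_le_mul (hcard _) ((hcard k).trans (hM (Nat.le_succ k)))
    have h2 : (0 : ℝ) < (D k).card := by exact_mod_cast Finset.card_pos.2 (hDne k)
    have h3 : (0 : ℝ) < M (k + 1) := by exact_mod_cast hMpos (k + 1)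
    have h4 : ((D k).card : ℝ) ≤ M (k + 1) * M (k + 1) := by exact_mod_cast h1
    have h5 : 0 ≤ Real.log (M (k + 1)) := Real.log_natCast_nonneg _
    rw [Real.sq_sqrt (by positivity)]
    calc Real.log (2 * (D k).card) ≤ Real.log (2 * (M (k + 1) * M (k + 1))) :=
          Real.log_le_log (by positivity) (by gcongr)
      _ = Real.log 2 + 2 * Real.log (M (k + 1)) := by
          rw [Real.log_mul (by norm_num) (by positivity), Real.log_mul h3.ne' h3.ne']; ring
      _ ≤ 2 * (1 + Real.log (M (k + 1))) := by linarith [Real.log_two_lt_d9]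
  let m : ℕ → (Fin n → Bool) → ℝ := fun k e => (D k).sup' (hDne k) fun d => |signSum e d|
  have hm : ∀ k, ∑ e, m k e ≤
      2 ^ n * (6 * a * (s / 2 ^ (k + 1)) * Real.sqrt (1 + Real.log (M (k + 1)))) := by
    intro k
    have h5 : 0 ≤ Real.log (M (k + 1)) := Real.log_natCast_nonneg _
    have := sum_max_signSum_le (D k) (3 * (a * (s / 2 ^ (k + 1))))
      (Real.sqrt (1 + Real.log (M (k + 1)))) (by positivity) (by positivity)
      (fun t ht => (Finset.mem_filter.1 ht).2) (hDcard k) (m k) (fun e => by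
        obtain ⟨d, hd, h⟩ := Finset.exists_mem_eq_sup' (hDne k) fun d => |signSum e d.ofLp|
        exact ⟨d, hd, h.le⟩)
    refine this.trans (le_of_eq ?_)
    ring
  have htel : ∀ e t K, signSum e (q K t) - signSum e (q 0 t)
      = ∑ k ∈ Finset.range K, signSum e (q (k + 1) t - q k t) := by
    intro e t K
    rw [← Finset.sum_range_sub (fun k => signSum e (q k t))]
    refine Finset.sum_congr rfl fun k _ => ?_
    exact (signSum_sub e _ _).symm
  have hpt : ∀ e, ∀ t ∈ T, |signSum e t| ≤
      ∑ k ∈ Finset.range K, m k e + n * (a * (s / 2 ^ K)) := by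
    intro e t ht
    have h1 : signSum e t = ∑ k ∈ Finset.range K, signSum e (q (k + 1) t - q k t)
        + signSum e (t - q K t) := by
      rw [← htel, hq0 0 rfl t, signSum_sub]
      simp [signSum]
    rw [h1]
    refine (abs_add_le _ _).trans (add_le_add ((Finset.abs_sum_le_sum_abs _ _).trans ?_) ?_)
    · refine Finset.sum_le_sum fun k _ => ?_
      exact Finset.le_sup' (fun d : EuclideanSpace ℝ (Fin n) => |signSum e d|) (hqD k t ht)
    · refine (abs_signSum_le e (t - q K t)).trans ?_
      have := (hqC K t ht).2
      gcongr
  have hnonneg : ∀ e, 0 ≤ ∑ k ∈ Finset.range K, m k e + n * (a * (s / 2 ^ K)) := by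
    intro e
    obtain ⟨t, ht⟩ := hne
    exact (abs_nonneg _).trans (hpt e t ht)
  calc ∑ e, ⨆ t ∈ T, ENNReal.ofReal |signSum e t|
      ≤ ∑ e, ENNReal.ofReal (∑ k ∈ Finset.range K, m k e + n * (a * (s / 2 ^ K))) := by
        refine Finset.sum_le_sum fun e _ => iSup₂_le fun t ht => ?_
        exact ENNReal.ofReal_le_ofReal (hpt e t ht)
    _ = ENNReal.ofReal (∑ e, (∑ k ∈ Finset.range K, m k e + n * (a * (s / 2 ^ K)))) :=
        (ENNReal.ofReal_sum_of_nonneg fun e _ => hnonneg e).symm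
    _ ≤ _ := by
        refine ENNReal.ofReal_le_ofReal ?_
        rw [Finset.sum_add_distrib, Finset.sum_comm]
        refine add_le_add (Finset.sum_le_sum fun k _ => hm k) (le_of_eq ?_)
        simp

/-- Dudley's entropy bound for Rademacher sums. -/
lemma sum_iSup_signSum_le {n : ℕ} (T : Set (EuclideanSpace ℝ (Fin n))) {a s : ℝ} (ha : 0 < a)
    (hs : 0 < s) (hT : ∀ t ∈ T, ‖t‖ ≤ a * s) (N : ℝ → ℕ∞)
    (hanti : ∀ u v, 0 < u → u ≤ v → N v ≤ N u)
    (hN : ∀ u, 0 < u → ∀ m : ℕ, N u = m → ∃ C : Finset (EuclideanSpace ℝ (Fin n)), C.card ≤ m ∧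
      ∀ t ∈ T, ∃ c ∈ C, ‖t - c‖ ≤ a * u) :
    ∑ e, ⨆ t ∈ T, ENNReal.ofReal |signSum e t| ≤
      2 ^ n * (12 * ENNReal.ofReal a * ∫⁻ u in Ioc 0 s, sqrtOneAddLog (N u)) := by
  rcases T.eq_empty_or_nonempty with rfl | hne
  · simp
  -- An infinite covering number at u stays infinite below u, so the integral diverges and the bound
  -- is trivial.
  by_cases htop : ∃ u, 0 < u ∧ u ≤ s ∧ N u = ⊤
  · obtain ⟨u, hu, hus, huN⟩ := htop
    have : ∫⁻ u in Ioc 0 s, sqrtOneAddLog (N u) = ⊤ := by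
      rw [eq_top_iff]
      calc (⊤ : ℝ≥0∞) = ∫⁻ _v in Ioc 0 u, (⊤ : ℝ≥0∞) := by
            rw [setLIntegral_const, Real.volume_Ioc, ENNReal.top_mul]
            simpa using hu
        _ ≤ ∫⁻ v in Ioc 0 u, sqrtOneAddLog (N v) := by
            refine setLIntegral_mono' measurableSet_Ioc fun v hv => ?_
            have : N v = ⊤ := by
              rw [eq_top_iff, ← huN]
              exact hanti v u hv.1 hv.2
            rw [this, sqrtOneAddLog_top]
        _ ≤ _ := lintegral_mono_set (Ioc_subset_Ioc_right hus)
    rw [this, ENNReal.mul_top, ENNReal.mul_top]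
    · exact le_top
    · positivity
    · simpa using ha
  push Not at htop
  have hpow : ∀ k : ℕ, 0 < s / 2 ^ k := fun k => by positivity
  have hpow' : ∀ k : ℕ, s / 2 ^ k ≤ s := fun k =>
    div_le_self hs.le (one_le_pow₀ (by norm_num))
  choose M hM using fun k => ENat.ne_top_iff_exists.1 (htop _ (hpow k) (hpow' k))
  choose C hCM hC using fun k => hN _ (hpow k) (M k) (hM k).symm
  have hMmono : Monotone M := by
    refine monotone_nat_of_le_succ fun k => ?_
    have := hanti _ _ (hpow (k + 1)) (show s / 2 ^ (k + 1) ≤ s / 2 ^ k by gcongr <;> norm_num)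
    rw [← hM, ← hM] at this
    exact_mod_cast this
  have hMne : ∀ k, M k ≠ 0 := by
    intro k
    obtain ⟨t, ht⟩ := hne
    obtain ⟨c, hc, -⟩ := hC k t ht
    exact ((Finset.card_pos.2 ⟨c, hc⟩).trans_le (hCM k)).ne'
  -- The unchained remainder is bounded crudely by n times the last radius, which vanishes as K
  -- grows with n fixed.
  have hK : ∀ K : ℕ, ∑ e, ⨆ t ∈ T, ENNReal.ofReal |signSum e t| ≤
      2 ^ n * (12 * ENNReal.ofReal a * ∫⁻ u in Ioc 0 s, sqrtOneAddLog (N u)) +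
      ENNReal.ofReal (2 ^ n * (n * (a * (s / 2 ^ K)))) := by
    intro K
    refine (sum_iSup_signSum_le_add T ha hs hne hT M hMmono C hCM hC K).trans ?_
    rw [ENNReal.ofReal_add (Finset.sum_nonneg fun k _ => by positivity) (by positivity)]
    gcongr
    have h1 := sum_dyadic_le_lintegral (fun u => sqrtOneAddLog (N u))
      (fun u v hu huv => sqrtOneAddLog_mono (hanti u v hu huv)) hs K
    rw [ENNReal.ofReal_sum_of_nonneg fun k _ => by positivity]
    calc ∑ k ∈ Finset.range K, ENNReal.ofReal (2 ^ n * (6 * a * (s / 2 ^ (k + 1)) *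
          Real.sqrt (1 + Real.log (M (k + 1)))))
        = 2 ^ n * (6 * ENNReal.ofReal a * ∑ k ∈ Finset.range K,
            ENNReal.ofReal (s / 2 ^ (k + 1)) * sqrtOneAddLog (N (s / 2 ^ (k + 1)))) := by
          rw [Finset.mul_sum, Finset.mul_sum]
          refine Finset.sum_congr rfl fun k _ => ?_
          rw [← hM, sqrtOneAddLog_natCast (hMne _), ENNReal.ofReal_mul (by positivity),
            ENNReal.ofReal_mul (by positivity), ENNReal.ofReal_mul (by positivity),
            ENNReal.ofReal_mul (by positivity), ENNReal.ofReal_pow (by norm_num)]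
          simp only [ENNReal.ofReal_ofNat]
          ring
      _ ≤ 2 ^ n * (6 * ENNReal.ofReal a * (2 * ∫⁻ u in Ioc 0 s, sqrtOneAddLog (N u))) := by
          gcongr
      _ = _ := by ring
  have hlim : Filter.Tendsto (fun K : ℕ =>
      2 ^ n * (12 * ENNReal.ofReal a * ∫⁻ u in Ioc 0 s, sqrtOneAddLog (N u)) +
      ENNReal.ofReal (2 ^ n * (n * (a * (s / 2 ^ K))))) Filter.atTop
      (nhds (2 ^ n * (12 * ENNReal.ofReal a * ∫⁻ u in Ioc 0 s, sqrtOneAddLog (N u)) + 0)) := by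
    refine Filter.Tendsto.add tendsto_const_nhds ?_
    rw [← ENNReal.ofReal_zero]
    refine ENNReal.tendsto_ofReal ?_
    have h0 : Filter.Tendsto (fun K : ℕ => ((1 : ℝ) / 2) ^ K) Filter.atTop (nhds 0) :=
      tendsto_pow_atTop_nhds_zero_of_lt_one (by norm_num) (by norm_num)
    have := h0.const_mul (2 ^ n * (n * (a * s)))
    rw [mul_zero] at this
    refine this.congr fun K => ?_
    rw [div_pow, one_pow]; ring
  rw [add_zero] at hlim
  exact ge_of_tendsto' hlim hK

/-! ### Growth of the entropy integral -/

variable {X : Type*} [MeasurableSpace X]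

/-- A dilation is a measurable embedding, so the change of variables needs no measurability of G. -/
lemma lintegral_Ioc_mul_left (G : ℝ → ℝ≥0∞) {c : ℝ} (hc : 0 < c) (t : ℝ) :
    ∫⁻ u in Ioc 0 (c * t), G u = ENNReal.ofReal c * ∫⁻ u in Ioc 0 t, G (c * u) := by
  have h := Real.smul_map_volume_mul_left hc.ne'
  have hemb : MeasurableEmbedding (c * · : ℝ → ℝ) :=
    (Homeomorph.mulLeft₀ c hc.ne').measurableEmbedding
  conv_lhs => rw [← h]
  rw [Measure.restrict_smul, lintegral_smul_measure, abs_of_pos hc, hemb.restrict_map,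
    hemb.lintegral_map, smul_eq_mul]
  congr 3
  ext u
  simp only [mem_preimage, mem_Ioc]
  constructor
  · rintro ⟨h1, h2⟩
    exact ⟨pos_of_mul_pos_right h1 hc.le, le_of_mul_le_mul_left h2 hc⟩
  · rintro ⟨h1, h2⟩
    exact ⟨by positivity, by gcongr⟩

/-- The primitive of a nonincreasing function grows at most linearly. -/
lemma lintegral_Ioc_le_of_antitone (G : ℝ → ℝ≥0∞) (hG : ∀ u v, 0 < u → u ≤ v → G v ≤ G u)
    (s : ℝ) {t : ℝ} (ht : 0 < t) :
    ∫⁻ u in Ioc 0 s, G u ≤ (1 + ENNReal.ofReal s / ENNReal.ofReal t) * ∫⁻ u in Ioc 0 t, G u := by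
  rcases le_or_gt s t with hst | hst
  · rw [add_mul, one_mul]
    exact (lintegral_mono_set (Ioc_subset_Ioc_right hst)).trans le_self_add
  · have hc : 0 < s / t := by
      have := ht.trans hst
      positivity
    have h1 := lintegral_Ioc_mul_left G hc t
    rw [div_mul_cancel₀ _ ht.ne', ENNReal.ofReal_div_of_pos ht] at h1
    rw [h1, add_mul]
    refine le_trans ?_ le_add_self
    gcongr _ * ?_
    refine setLIntegral_mono' measurableSet_Ioc fun u hu => ?_
    refine hG _ _ hu.1 ?_
    have : 1 ≤ s / t := (one_le_div ht).2 hst.le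
    nlinarith [hu.1]

lemma coveringNumber_anti {ε η : ℝ≥0} (h : ε ≤ η) (𝓕 : Set (X → ℝ)) (r : ℝ≥0∞) [Fact (1 ≤ r)]
    (Q : Measure X) : coveringNumber η 𝓕 r Q ≤ coveringNumber ε 𝓕 r Q :=
  Metric.externalCoveringNumber_anti h

/-- For each Q the integrand is nonincreasing in ε, and linear growth of its primitive passes to the
supremum. A sample-dependent s can thus be exchanged for a fixed t. -/
lemma uniformEntropyIntegral_le (𝓕 : Set (X → ℝ)) (F : X → ℝ) (r : ℝ≥0∞) [Fact (1 ≤ r)] (s : ℝ)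
    {t : ℝ} (ht : 0 < t) :
    uniformEntropyIntegral s 𝓕 F r ≤
      (1 + ENNReal.ofReal s / ENNReal.ofReal t) * uniformEntropyIntegral t 𝓕 F r := by
  refine iSup₂_le fun Q hQ => ?_
  refine (lintegral_Ioc_le_of_antitone _ (fun u v _ huv => ?_) s ht).trans ?_
  · refine sqrtOneAddLog_mono (coveringNumber_anti ?_ _ _ _)
    gcongr
  · gcongr
    exact le_iSup₂ (f := fun (Q : Measure X) (_ : IsFinitelyDiscreteProbability Q) =>
      ∫⁻ ε in Ioc (0 : ℝ) t,
        sqrtOneAddLog (coveringNumber (ε.toNNReal * (eLpNorm F r Q).toNNReal) 𝓕 r Q)) Q hQ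

/-! ### Discrete measures on the sample and their coverings -/

/-- The discrete measure with mass `w i` at the point `x i`. -/
def weightedMeasure {n : ℕ} (x : Fin n → X) (w : Fin n → ℝ≥0) : Measure X :=
  ∑ i, w i • Measure.dirac (x i)

lemma isFinitelyDiscreteProbability_weightedMeasure {n : ℕ} (x : Fin n → X) (w : Fin n → ℝ≥0)
    (hw : ∑ i, w i = 1) : IsFinitelyDiscreteProbability (weightedMeasure x w) := by
  classical
  constructor
  · constructor
    simp only [weightedMeasure, Measure.coe_finsetSum, Finset.sum_apply, Measure.smul_apply,
      measure_univ, ENNReal.smul_def, smul_eq_mul, mul_one]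
    exact_mod_cast hw
  -- Sample points may coincide, so the weight at y collects the whole fibre of x.
  · refine ⟨Finset.univ.image x, fun y => ∑ i with x i = y, w i, ?_⟩
    rw [weightedMeasure, ← Finset.sum_fiberwise_of_maps_to (g := x) (t := Finset.univ.image x)
      (fun i _ => Finset.mem_image_of_mem _ (Finset.mem_univ i))]
    refine Finset.sum_congr rfl fun y _ => ?_
    rw [Finset.sum_smul]
    refine Finset.sum_congr rfl fun i hi => ?_
    rw [(Finset.mem_filter.1 hi).2]

lemma eLpNorm_weightedMeasure {n : ℕ} (x : Fin n → X) (w : Fin n → ℝ≥0) {g : X → ℝ}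
    (hg : Measurable g) :
    eLpNorm g 2 (weightedMeasure x w) = ENNReal.ofReal (Real.sqrt (∑ i, w i * g (x i) ^ 2)) := by
  rw [eLpNorm_eq_lintegral_rpow_enorm_toReal (by norm_num) (by norm_num), weightedMeasure,
    lintegral_finsetSum_measure]
  have h1 : ∀ i, ∫⁻ y, ‖g y‖ₑ ^ (2 : ℝ≥0∞).toReal ∂(w i • Measure.dirac (x i))
      = ENNReal.ofReal (w i * g (x i) ^ 2) := by
    intro i
    rw [lintegral_smul_measure, lintegral_dirac' _ (by fun_prop), ENNReal.smul_def, smul_eq_mul,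
      ENNReal.ofReal_mul (by positivity), ENNReal.ofReal_coe_nnreal, Real.enorm_eq_ofReal_abs,
      ENNReal.ofReal_rpow_of_nonneg (by positivity) (by positivity)]
    simp
  simp_rw [h1]
  rw [← ENNReal.ofReal_sum_of_nonneg fun i _ => by positivity,
    ENNReal.ofReal_rpow_of_nonneg (Finset.sum_nonneg fun i _ => by positivity) (by norm_num),
    Real.sqrt_eq_rpow]
  simp

lemma memLp_weightedMeasure {n : ℕ} (x : Fin n → X) (w : Fin n → ℝ≥0) {g : X → ℝ}
    (hg : Measurable g) : MemLp g 2 (weightedMeasure x w) :=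
  ⟨hg.aestronglyMeasurable, by rw [eLpNorm_weightedMeasure x w hg]; exact ENNReal.ofReal_lt_top⟩

/-- A finite covering number in `L₂` of a discrete measure gives finitely many centres that are
close at the atoms. -/
lemma exists_finset_of_coveringNumber_eq {n : ℕ} (x : Fin n → X) (w : Fin n → ℝ≥0)
    {𝓕 : Set (X → ℝ)} (h𝓕 : ∀ f ∈ 𝓕, Measurable f) {ρ : ℝ≥0} {m : ℕ}
    (h : coveringNumber ρ 𝓕 2 (weightedMeasure x w) = m) :
    ∃ C : Finset (X → ℝ), C.card ≤ m ∧
      ∀ f ∈ 𝓕, ∃ g ∈ C, ∑ i, w i * (f (x i) - g (x i)) ^ 2 ≤ (ρ : ℝ) ^ 2 := by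
  classical
  have hlt : coveringNumber ρ 𝓕 2 (weightedMeasure x w) < (m + 1 : ℕ) := by
    rw [h]; exact_mod_cast Nat.lt_succ_self m
  unfold coveringNumber Metric.externalCoveringNumber at hlt
  simp only [iInf_lt_iff] at hlt
  obtain ⟨C, hC, hcard⟩ := hlt
  have hfin : C.Finite := Set.encard_lt_top_iff.1 (hcard.trans_le le_top)
  refine ⟨hfin.toFinset.image (fun g : Lp ℝ 2 (weightedMeasure x w) => (g : X → ℝ)), ?_, ?_⟩
  · refine Finset.card_image_le.trans ?_
    rw [hfin.encard_eq_coe_toFinset_card] at hcard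
    have : hfin.toFinset.card < m + 1 := by exact_mod_cast hcard
    omega
  · intro f hf
    have hfL := memLp_weightedMeasure x w (h𝓕 f hf)
    obtain ⟨g, hg, hfg⟩ := hC (show hfL.toLp f ∈ _ from ⟨f, hf, hfL.coeFn_toLp⟩)
    refine ⟨g, Finset.mem_image_of_mem _ (hfin.mem_toFinset.2 hg), ?_⟩
    -- Singletons of X need not be measurable; a measurable representative is what allows
    -- integration against point masses to be evaluation.
    have hgm : Measurable (g : X → ℝ) := (Lp.stronglyMeasurable g).measurable
    have h1 : eLpNorm (f - (g : X → ℝ)) 2 (weightedMeasure x w) ≤ ρ := by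
      have : edist (hfL.toLp f) g ≤ ρ := hfg
      rw [Lp.edist_def] at this
      refine le_trans (le_of_eq (eLpNorm_congr_ae ?_)) this
      filter_upwards [hfL.coeFn_toLp] with y hy
      simp [hy]
    rw [eLpNorm_weightedMeasure x w ((h𝓕 f hf).sub hgm), ← ENNReal.ofReal_coe_nnreal,
      ENNReal.ofReal_le_ofReal_iff ρ.coe_nonneg,
      Real.sqrt_le_left ρ.coe_nonneg] at h1
    exact h1

/-- Entropy bound for Rademacher sums over a set of vectors whose covering numbers are controlled
by those of `𝓕` in `L₂` of a finitely discrete probability. -/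
lemma sum_iSup_signSum_le_uniformEntropyIntegral {n : ℕ} {𝓕 : Set (X → ℝ)} (F : X → ℝ)
    (T : Set (EuclideanSpace ℝ (Fin n))) {a ρ t : ℝ} (ha : 0 < a) (hρ : 0 ≤ ρ) (ht : 0 < t)
    (hT : ∀ v ∈ T, ‖v‖ ≤ ρ) {Q : Measure X} (hQ : IsFinitelyDiscreteProbability Q)
    (hcover : ∀ u : ℝ, 0 < u → ∀ m : ℕ,
      coveringNumber (u.toNNReal * (eLpNorm F 2 Q).toNNReal) 𝓕 2 Q = m →
      ∃ C : Finset (EuclideanSpace ℝ (Fin n)), C.card ≤ m ∧ ∀ v ∈ T, ∃ c ∈ C, ‖v - c‖ ≤ a * u) :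
    ∑ e, ⨆ v ∈ T, ENNReal.ofReal |signSum e v| ≤
      2 ^ n * (12 * uniformEntropyIntegral t 𝓕 F 2 *
        (ENNReal.ofReal a + ENNReal.ofReal ρ / ENNReal.ofReal t)) := by
  -- Chaining runs up to s = ρ / a, which must be positive; for ρ = 0 all vectors vanish.
  rcases hρ.eq_or_lt with rfl | hρ
  · refine le_of_eq_of_le (Finset.sum_eq_zero fun e _ => ?_) zero_le
    simp only [ENNReal.iSup_eq_zero]
    intro v hv
    have : v = 0 := norm_le_zero_iff.1 (hT v hv)
    simp [this, signSum]
  · have h1 := sum_iSup_signSum_le T ha (s := ρ / a) (by positivity)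
      (fun v hv => by rw [mul_div_cancel₀ _ ha.ne']; exact hT v hv)
      (fun u => coveringNumber (u.toNNReal * (eLpNorm F 2 Q).toNNReal) 𝓕 2 Q)
      (fun u v _ huv => coveringNumber_anti (by gcongr) _ _ _) hcover
    refine h1.trans ?_
    have h2 : ∫⁻ u in Ioc 0 (ρ / a),
        sqrtOneAddLog (coveringNumber (u.toNNReal * (eLpNorm F 2 Q).toNNReal) 𝓕 2 Q) ≤
        (1 + ENNReal.ofReal (ρ / a) / ENNReal.ofReal t) * uniformEntropyIntegral t 𝓕 F 2 := by
      refine le_trans ?_ (uniformEntropyIntegral_le 𝓕 F 2 (ρ / a) ht)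
      exact le_iSup₂ (f := fun (Q : Measure X) (_ : IsFinitelyDiscreteProbability Q) =>
        ∫⁻ ε in Ioc (0 : ℝ) (ρ / a),
          sqrtOneAddLog (coveringNumber (ε.toNNReal * (eLpNorm F 2 Q).toNNReal) 𝓕 2 Q)) Q hQ
    calc _ ≤ 2 ^ n * (12 * ENNReal.ofReal a * ((1 + ENNReal.ofReal (ρ / a) / ENNReal.ofReal t) *
          uniformEntropyIntegral t 𝓕 F 2)) := by gcongr
      _ = 2 ^ n * (12 * uniformEntropyIntegral t 𝓕 F 2 * (ENNReal.ofReal a +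
          (ENNReal.ofReal a * ENNReal.ofReal (ρ / a)) / ENNReal.ofReal t)) := by
          simp only [div_eq_mul_inv]; ring
      _ = _ := by
          rw [← ENNReal.ofReal_mul ha.le, mul_div_cancel₀ _ ha.ne']

/-! ### Entropy bounds at a fixed sample -/

/-- The mean over all signs of the supremum of the Rademacher sums at the points `x`. -/
def rademacherSup {n : ℕ} (𝓖 : Set (X → ℝ)) (x : Fin n → X) : ℝ≥0∞ :=
  (2 ^ n)⁻¹ * ∑ e : Fin n → Bool, ⨆ g ∈ 𝓖, ENNReal.ofReal |∑ i, sign (e i) * g (x i)|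

/-- The supremum over `𝓕` of the sums of squares at the points `x`. -/
def supSumSq {n : ℕ} (𝓕 : Set (X → ℝ)) (x : Fin n → X) : ℝ≥0∞ :=
  ⨆ f ∈ 𝓕, ∑ i, ‖f (x i)‖ₑ ^ 2

lemma enorm_eq_sum_rpow {n : ℕ} (v : EuclideanSpace ℝ (Fin n)) :
    ‖v‖ₑ = (∑ i, ‖v i‖ₑ ^ 2) ^ (1 / 2 : ℝ) := by
  rw [← ofReal_norm, EuclideanSpace.norm_eq, Real.sqrt_eq_rpow,
    ← ENNReal.ofReal_rpow_of_nonneg (Finset.sum_nonneg fun i _ => by positivity) (by norm_num),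
    ENNReal.ofReal_sum_of_nonneg fun i _ => by positivity]
  congr 1
  refine Finset.sum_congr rfl fun i _ => ?_
  rw [ENNReal.ofReal_pow (norm_nonneg _), ofReal_norm]

lemma ofReal_sqrt_sum_sq {n : ℕ} (v : Fin n → ℝ) :
    ENNReal.ofReal (Real.sqrt (∑ i, v i ^ 2)) = (∑ i, ‖v i‖ₑ ^ 2) ^ (1 / 2 : ℝ) := by
  have := enorm_eq_sum_rpow (WithLp.toLp 2 v)
  rw [← ofReal_norm, EuclideanSpace.norm_eq] at this
  simpa using this

lemma enorm_le_of_isEnvelope {F : X → ℝ} {𝓕 : Set (X → ℝ)} (hF : IsEnvelope F 𝓕) {f : X → ℝ}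
    (hf : f ∈ 𝓕) (y : X) : ‖f y‖ₑ ≤ ‖F y‖ₑ := by
  rw [enorm_le_iff_norm_le, Real.norm_eq_abs, Real.norm_eq_abs]
  exact (hF.2 f hf y).trans (le_abs_self _)

lemma supSumSq_le {n : ℕ} {F : X → ℝ} {𝓕 : Set (X → ℝ)} (hF : IsEnvelope F 𝓕) (x : Fin n → X) :
    supSumSq 𝓕 x ≤ ∑ i, ‖F (x i)‖ₑ ^ 2 :=
  iSup₂_le fun f hf => Finset.sum_le_sum fun i _ => by
    gcongr
    exact enorm_le_of_isEnvelope hF hf _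

lemma sum_enorm_pow_ne_top {Y : Type*} {n : ℕ} (F : Y → ℝ) (x : Fin n → Y) (k : ℕ) :
    ∑ i, ‖F (x i)‖ₑ ^ k ≠ ⊤ :=
  ENNReal.sum_ne_top.2 fun _ _ => ENNReal.pow_ne_top enorm_ne_top

lemma supSumSq_ne_top {n : ℕ} {F : X → ℝ} {𝓕 : Set (X → ℝ)} (hF : IsEnvelope F 𝓕)
    (x : Fin n → X) : supSumSq 𝓕 x ≠ ⊤ :=
  ne_top_of_le_ne_top (sum_enorm_pow_ne_top F x 2) (supSumSq_le hF x)

/-- Entropy bound for `rademacherSup` of a transformed class `{φ f : f ∈ 𝓕}`. -/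
lemma rademacherSup_image_le {n : ℕ} {𝓕 : Set (X → ℝ)} (F : X → ℝ) (φ : (X → ℝ) → X → ℝ)
    (x : Fin n → X) {a t : ℝ} (ha : 0 < a) (ht : 0 < t) {ρ : ℝ≥0∞} (hρ : ρ ≠ ⊤)
    (hT : ∀ f ∈ 𝓕, (∑ i, ‖φ f (x i)‖ₑ ^ 2) ^ (1 / 2 : ℝ) ≤ ρ)
    {Q : Measure X} (hQ : IsFinitelyDiscreteProbability Q)
    (hcover : ∀ u : ℝ, 0 < u → ∀ m : ℕ,
      coveringNumber (u.toNNReal * (eLpNorm F 2 Q).toNNReal) 𝓕 2 Q = m →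
      ∃ C : Finset (X → ℝ), C.card ≤ m ∧
        ∀ f ∈ 𝓕, ∃ c ∈ C, ∑ i, (φ f (x i) - c (x i)) ^ 2 ≤ (a * u) ^ 2) :
    rademacherSup (φ '' 𝓕) x ≤ 12 * uniformEntropyIntegral t 𝓕 F 2 *
        (ENNReal.ofReal a + ρ / ENNReal.ofReal t) := by
  classical
  let V : (X → ℝ) → EuclideanSpace ℝ (Fin n) := fun g => WithLp.toLp 2 fun i => g (x i)
  have h := sum_iSup_signSum_le_uniformEntropyIntegral (𝓕 := 𝓕) F (V '' (φ '' 𝓕)) ha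
    (ENNReal.toReal_nonneg (a := ρ)) ht ?_ hQ ?_
  · unfold rademacherSup
    rw [ENNReal.ofReal_toReal hρ] at h
    simp only [iSup_image] at h ⊢
    rw [ENNReal.inv_mul_le_iff (by positivity) (by finiteness)]
    exact h
  · rintro _ ⟨_, ⟨f, hf, rfl⟩, rfl⟩
    rw [← toReal_enorm]
    refine ENNReal.toReal_mono hρ ?_
    rw [enorm_eq_sum_rpow]
    exact hT f hf
  · intro u hu m hm
    obtain ⟨C, hC, hCf⟩ := hcover u hu m hm
    refine ⟨C.image V, Finset.card_image_le.trans hC, ?_⟩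
    rintro _ ⟨_, ⟨f, hf, rfl⟩, rfl⟩
    obtain ⟨c, hc, hfc⟩ := hCf f hf
    refine ⟨V c, Finset.mem_image_of_mem _ hc, ?_⟩
    refine abs_le_of_sq_le_sq' ?_ (by positivity) |>.2
    rw [EuclideanSpace.real_norm_sq_eq]
    exact hfc

lemma rademacherSup_eq_zero {Y : Type*} {n : ℕ} {𝓖 : Set (Y → ℝ)} {x : Fin n → Y}
    (h : ∀ g ∈ 𝓖, ∀ i, g (x i) = 0) : rademacherSup 𝓖 x = 0 := by
  unfold rademacherSup
  rw [Finset.sum_eq_zero, mul_zero]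
  intro e _
  simp only [ENNReal.iSup_eq_zero]
  intro g hg
  simp [h g hg]

/-- Entropy bound for the Rademacher sums of `𝓕`. -/
lemma rademacherSup_le {n : ℕ} (hn : 1 ≤ n) {𝓕 : Set (X → ℝ)} {F : X → ℝ}
    (h𝓕 : ∀ f ∈ 𝓕, Measurable f) (hF : IsEnvelope F 𝓕) (x : Fin n → X) {t : ℝ} (ht : 0 < t) :
    rademacherSup 𝓕 x ≤ 12 * uniformEntropyIntegral t 𝓕 F 2 *
      ((∑ i, ‖F (x i)‖ₑ ^ 2) ^ (1 / 2 : ℝ) + supSumSq 𝓕 x ^ (1 / 2 : ℝ) / ENNReal.ofReal t) := by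
  have hn0 : (0 : ℝ) < n := by exact_mod_cast hn
  rcases (Finset.sum_nonneg (s := Finset.univ) fun i _ => sq_nonneg (F (x i))).eq_or_lt with h0 | h0
  · rw [rademacherSup_eq_zero]
    · exact zero_le
    · intro f hf i
      have h1 := (Finset.sum_eq_zero_iff_of_nonneg fun i _ => sq_nonneg (F (x i))).1 h0.symm i
        (Finset.mem_univ i)
      have h2 := hF.2 f hf (x i)
      rw [pow_eq_zero_iff two_ne_zero] at h1
      rw [h1] at h2
      exact abs_nonpos_iff.1 h2
  · rw [← ofReal_sqrt_sum_sq]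
    have := rademacherSup_image_le (𝓕 := 𝓕) F id x (Real.sqrt_pos.2 h0) ht
      (ρ := supSumSq 𝓕 x ^ (1 / 2 : ℝ))
      (ENNReal.rpow_ne_top_of_nonneg (by norm_num) (supSumSq_ne_top hF x))
      (fun f hf => by
        gcongr
        exact le_iSup₂ (f := fun (f : X → ℝ) (_ : f ∈ 𝓕) => ∑ i, ‖f (x i)‖ₑ ^ 2) f hf)
      -- Q is the empirical measure; its factor 1/n cancels between distance and radius, leaving the
      -- scale a = √(Σ F(x_i)²).
      (isFinitelyDiscreteProbability_weightedMeasure x (fun _ => (n : ℝ≥0)⁻¹) (by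
        have : (n : ℝ≥0) ≠ 0 := by positivity
        simp [this]))
      (fun u hu m hm => by
        obtain ⟨C, hC, hCf⟩ := exists_finset_of_coveringNumber_eq x _ h𝓕 hm
        refine ⟨C, hC, fun f hf => ?_⟩
        obtain ⟨g, hg, hfg⟩ := hCf f hf
        refine ⟨g, hg, ?_⟩
        rw [eLpNorm_weightedMeasure x _ hF.1] at hfg
        simp only [NNReal.coe_mul, Real.coe_toNNReal _ hu.le, ENNReal.coe_toNNReal_eq_toReal,
          ENNReal.toReal_ofReal (Real.sqrt_nonneg _), NNReal.coe_inv, NNReal.coe_natCast, mul_pow,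
          ← Finset.mul_sum] at hfg
        rw [Real.sq_sqrt (by positivity)] at hfg
        simp only [id, mul_pow]
        rw [Real.sq_sqrt h0.le]
        have h3 : (n : ℝ)⁻¹ * ∑ i, (f (x i) - g (x i)) ^ 2 ≤
            (n : ℝ)⁻¹ * ((∑ i, F (x i) ^ 2) * u ^ 2) := by linarith
        exact le_of_mul_le_mul_left h3 (by positivity))
    rwa [image_id] at this

/-- Projection onto [-F, F] is 1-Lipschitz and fixes a. -/
lemma abs_sub_clip_le {a b F : ℝ} (ha : |a| ≤ F) : |a - max (-F) (min b F)| ≤ |a - b| := by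
  have h := abs_le.1 ha
  rcases le_total b F with h1 | h1 <;> rcases le_total (-F) b with h2 | h2 <;>
    simp only [abs_le, min_eq_left h1, min_eq_right h1, max_eq_right h2, max_eq_left h2] <;>
    cases abs_cases (a - b) <;> grind

/-- Factor a² - c² = (a + c)(a - c). Centres of a cover are arbitrary, and clipping them is what
makes |a + c| ≤ 2F. -/
lemma sq_sub_sq_clip_le {a b F : ℝ} (ha : |a| ≤ F) :
    (a ^ 2 - (max (-F) (min b F)) ^ 2) ^ 2 ≤ 4 * (F ^ 2 * (a - b) ^ 2) := by
  have h0 : 0 ≤ F := (abs_nonneg a).trans ha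
  have h1 := abs_sub_clip_le (b := b) ha
  set c := max (-F) (min b F) with hc
  have hcF : |c| ≤ F := abs_le.2 ⟨le_max_left _ _, max_le (by linarith) (min_le_right _ _)⟩
  have h2 : |a + c| ≤ 2 * F := (abs_add_le _ _).trans (by linarith)
  calc (a ^ 2 - c ^ 2) ^ 2 = |a + c| ^ 2 * |a - c| ^ 2 := by rw [sq_abs, sq_abs]; ring
    _ ≤ (2 * F) ^ 2 * |a - b| ^ 2 := by gcongr
    _ = _ := by rw [sq_abs]; ring

/-- Hölder's inequality for the sums of fourth powers. -/
lemma sum_enorm_pow_four_le {n : ℕ} {p : ℝ} (hp : 1 < p) (f F : Fin n → ℝ)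
    (hfF : ∀ i, ‖f i‖ₑ ≤ ‖F i‖ₑ) :
    ∑ i, ‖f i‖ₑ ^ 4 ≤ (∑ i, ‖f i‖ₑ ^ 2) ^ (1 / p) *
      (∑ i, ‖F i‖ₑ ^ ((4 * p - 2) / (p - 1))) ^ (1 - 1 / p) := by
  have hp0 : 0 < p := by linarith
  have hr : 1 / p < 1 := (div_lt_one hp0).2 hp
  have h := ENNReal.lintegral_mul_norm_pow_le (μ := Measure.count)
    (f := fun i => ‖f i‖ₑ ^ 2) (g := fun i => ‖F i‖ₑ ^ ((4 * p - 2) / (p - 1)))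
    (p := 1 / p) (q := 1 - 1 / p) (by fun_prop) (by fun_prop)
    (by positivity) (by linarith) (by ring)
  simp only [lintegral_count, tsum_fintype] at h
  refine le_trans (Finset.sum_le_sum fun i _ => ?_) h
  have hp1 : p - 1 ≠ 0 := by linarith
  -- The exponent R = (4p-2)/(p-1) is chosen so that 4 = 2/p + R(1 - 1/p).
  calc ‖f i‖ₑ ^ 4 = ‖f i‖ₑ ^ (2 * (1 / p)) * ‖f i‖ₑ ^ (((4 * p - 2) / (p - 1)) * (1 - 1 / p)) := by
        rw [← ENNReal.rpow_add_of_nonneg, ← ENNReal.rpow_natCast]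
        · congr 1
          field_simp
          push_cast
          ring
        · positivity
        · refine mul_nonneg (div_nonneg ?_ ?_) ?_ <;> linarith
    _ ≤ ‖f i‖ₑ ^ (2 * (1 / p)) * ‖F i‖ₑ ^ (((4 * p - 2) / (p - 1)) * (1 - 1 / p)) := by
        gcongr
        · refine mul_nonneg (div_nonneg ?_ ?_) ?_ <;> linarith
        · exact hfF i
    _ = _ := by
        rw [ENNReal.rpow_mul, ENNReal.rpow_mul, ENNReal.rpow_ofNat]

/-- Entropy bound for the Rademacher sums of the class of squares. -/
lemma rademacherSup_powClass_two_le {n : ℕ} {𝓕 : Set (X → ℝ)} {F : X → ℝ}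
    (h𝓕 : ∀ f ∈ 𝓕, Measurable f) (hF : IsEnvelope F 𝓕) (x : Fin n → X) {p t : ℝ} (hp : 1 < p)
    (ht : 0 < t) :
    rademacherSup (powClass 𝓕 2) x ≤ 12 * uniformEntropyIntegral t 𝓕 F 2 *
      (2 * ((∑ i, ‖F (x i)‖ₑ ^ 2) ^ (1 / p) *
        (∑ i, ‖F (x i)‖ₑ ^ ((4 * p - 2) / (p - 1))) ^ (1 - 1 / p)) ^ (1 / 2 : ℝ) +
      (supSumSq 𝓕 x ^ (1 / p) *
        (∑ i, ‖F (x i)‖ₑ ^ ((4 * p - 2) / (p - 1))) ^ (1 - 1 / p)) ^ (1 / 2 : ℝ) /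
          ENNReal.ofReal t) := by
  have hp0 : 0 < p := by linarith
  have hr : 1 / p < 1 := (div_lt_one hp0).2 hp
  rcases (Finset.sum_nonneg (s := Finset.univ) fun i _ => sq_nonneg (F (x i))).eq_or_lt with h0 | h0
  · rw [rademacherSup_eq_zero]
    · exact zero_le
    · rintro _ ⟨f, hf, rfl⟩ i
      have h1 := (Finset.sum_eq_zero_iff_of_nonneg fun i _ => sq_nonneg (F (x i))).1 h0.symm i
        (Finset.mem_univ i)
      have h2 := hF.2 f hf (x i)
      rw [pow_eq_zero_iff two_ne_zero] at h1
      rw [h1] at h2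
      simp [abs_nonpos_iff.1 h2]
  have h4 : 0 < ∑ i, (F (x i) ^ 2) ^ 2 := by
    obtain ⟨i, -, hi⟩ := Finset.exists_ne_zero_of_sum_ne_zero h0.ne'
    exact Finset.sum_pos' (fun i _ => by positivity) ⟨i, Finset.mem_univ i, by positivity⟩
  have hsum4 : ∀ f : X → ℝ, ∑ i, ‖f (x i) ^ 2‖ₑ ^ 2 = ∑ i, ‖f (x i)‖ₑ ^ 4 := fun f =>
    Finset.sum_congr rfl fun i _ => by rw [enorm_pow, ← pow_mul]
  -- With weights proportional to F², squared Q-distance is Σ F²(f-g)² / Σ F² and ‖F‖²_{Q,2} = Σ F⁴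
  -- / Σ F². The denominators cancel, so the squares are covered at scale a = 2√(Σ F⁴).
  let w : Fin n → ℝ≥0 := fun i => ⟨F (x i) ^ 2 / ∑ j, F (x j) ^ 2, by positivity⟩
  have hw : ∀ i, (w i : ℝ) = F (x i) ^ 2 / ∑ j, F (x j) ^ 2 := fun i => rfl
  have hARtop : ∑ i, ‖F (x i)‖ₑ ^ ((4 * p - 2) / (p - 1)) ≠ ⊤ :=
    ENNReal.sum_ne_top.2 fun i _ => ENNReal.rpow_ne_top_of_nonneg
      (div_nonneg (by linarith) (by linarith)) enorm_ne_top
  have key := rademacherSup_image_le (𝓕 := 𝓕) F (fun f => fun y => f y ^ 2) x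
    (a := 2 * Real.sqrt (∑ i, (F (x i) ^ 2) ^ 2)) (t := t)
    (mul_pos two_pos (Real.sqrt_pos.2 h4)) ht
    (ρ := (supSumSq 𝓕 x ^ (1 / p) *
        (∑ i, ‖F (x i)‖ₑ ^ ((4 * p - 2) / (p - 1))) ^ (1 - 1 / p)) ^ (1 / 2 : ℝ))
    (ENNReal.rpow_ne_top_of_nonneg (by norm_num) (ENNReal.mul_ne_top
      (ENNReal.rpow_ne_top_of_nonneg (by positivity) (supSumSq_ne_top hF x))
      (ENNReal.rpow_ne_top_of_nonneg (by linarith) hARtop)))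
    (fun f hf => by
      rw [hsum4 f]
      refine ENNReal.rpow_le_rpow ?_ (by norm_num)
      refine (sum_enorm_pow_four_le hp (fun i => f (x i)) (fun i => F (x i))
        fun i => enorm_le_of_isEnvelope hF hf _).trans ?_
      gcongr
      exact le_iSup₂ (f := fun (f : X → ℝ) (_ : f ∈ 𝓕) => ∑ i, ‖f (x i)‖ₑ ^ 2) f hf)
    (isFinitelyDiscreteProbability_weightedMeasure x w (by
      rw [← NNReal.coe_inj]
      push_cast
      simp only [hw]
      rw [← Finset.sum_div, div_self h0.ne']))
    (fun u hu m hm => by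
      classical
      obtain ⟨C, hC, hCf⟩ := exists_finset_of_coveringNumber_eq x w h𝓕 hm
      refine ⟨C.image fun g y => (max (-F y) (min (g y) (F y))) ^ 2,
        Finset.card_image_le.trans hC, fun f hf => ?_⟩
      obtain ⟨g, hg, hfg⟩ := hCf f hf
      refine ⟨_, Finset.mem_image_of_mem _ hg, ?_⟩
      rw [eLpNorm_weightedMeasure x w hF.1] at hfg
      simp only [NNReal.coe_mul, Real.coe_toNNReal _ hu.le, ENNReal.coe_toNNReal_eq_toReal,
          ENNReal.toReal_ofReal (Real.sqrt_nonneg _), mul_pow] at hfg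
      rw [Real.sq_sqrt (by positivity)] at hfg
      simp only [hw, div_mul_eq_mul_div, ← Finset.sum_div] at hfg
      simp only [mul_pow]
      rw [Real.sq_sqrt h4.le]
      calc ∑ i, (f (x i) ^ 2 - (max (-F (x i)) (min (g (x i)) (F (x i)))) ^ 2) ^ 2
          ≤ ∑ i, 4 * (F (x i) ^ 2 * (f (x i) - g (x i)) ^ 2) :=
            Finset.sum_le_sum fun i _ => sq_sub_sq_clip_le (hF.2 f hf (x i))
        _ = 4 * ∑ i, F (x i) ^ 2 * (f (x i) - g (x i)) ^ 2 := by rw [Finset.mul_sum]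
        _ ≤ 4 * (u ^ 2 * ∑ i, F (x i) ^ 2 * F (x i) ^ 2) := by
            rw [← mul_div_assoc, div_le_div_iff_of_pos_right h0] at hfg
            linarith
        _ = 2 ^ 2 * (∑ i, (F (x i) ^ 2) ^ 2) * u ^ 2 := by
            simp only [← sq]; ring)
  refine key.trans ?_
  gcongr
  rw [ENNReal.ofReal_mul two_pos.le, ofReal_sqrt_sum_sq, ENNReal.ofReal_ofNat, hsum4 F]
  gcongr
  exact sum_enorm_pow_four_le hp (fun i => F (x i)) (fun i => F (x i)) fun i => le_rfl

/-! ### Symmetrization -/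

/-- The supremum over `𝓖` of the absolute values of the weighted sums `∑ i, s i * g (z i)`. -/
def weightedSup {ι : Type*} [Fintype ι] (𝓖 : Set (X → ℝ)) (s : ι → ℝ) (z : ι → X) : ℝ≥0∞ :=
  ⨆ g ∈ 𝓖, ENNReal.ofReal |∑ i, s i * g (z i)|

lemma measurePreserving_comp_equiv_symm {ι κ : Type*} [Fintype ι] [Fintype κ] (P : Measure X)
    [SigmaFinite P] (f : ι ≃ κ) :
    MeasurePreserving (fun (z : ι → X) (k : κ) => z (f.symm k)) (Measure.pi fun _ => P)
      (Measure.pi fun _ => P) := by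
  have h := measurePreserving_piCongrLeft (fun _ : κ => P) f
  have heq : (MeasurableEquiv.piCongrLeft (fun _ : κ => X) f : (ι → X) → κ → X)
      = fun z k => z (f.symm k) := by
    ext z k
    obtain ⟨i, rfl⟩ := f.surjective k
    rw [MeasurableEquiv.coe_piCongrLeft, Equiv.piCongrLeft_apply_apply, Equiv.symm_apply_apply]
  rwa [heq] at h

lemma weightedSup_comp_equiv_symm {Y ι κ : Type*} [Fintype ι] [Fintype κ] (𝓖 : Set (Y → ℝ))
    (f : ι ≃ κ) (s : κ → ℝ) (z : ι → Y) :
    weightedSup 𝓖 s (fun k => z (f.symm k)) = weightedSup 𝓖 (s ∘ f) z := by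
  unfold weightedSup
  refine iSup_congr fun g => iSup_congr fun _ => ?_
  rw [← Equiv.sum_comp f]
  simp

/-- Transfers measurability from `Fin n` to any finite index type, as needed for the doubled sample
indexed by `Fin n ⊕ Fin n`. -/
lemma PMeasurable.aemeasurable_weightedSup {P : Measure X} [IsProbabilityMeasure P]
    {𝓖 : Set (X → ℝ)} (h : PMeasurable P 𝓖) {ι : Type*} [Fintype ι] (s : ι → ℝ)
    (hs : ∀ i, s i = 1 ∨ s i = -1) :
    AEMeasurable (weightedSup 𝓖 s) (Measure.pi fun _ => P) := by
  let f := Fintype.equivFin ι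
  have h1 : AEMeasurable (weightedSup 𝓖 (s ∘ f.symm)) (Measure.pi fun _ => P) :=
    (h (Fintype.card ι) (s ∘ f.symm) fun i => hs _).aemeasurable
  have h2 := h1.comp_quasiMeasurePreserving
    (measurePreserving_comp_equiv_symm P f).quasiMeasurePreserving
  refine h2.congr (Filter.Eventually.of_forall fun z => ?_)
  simp only [Function.comp_apply]
  rw [weightedSup_comp_equiv_symm]
  congr 1
  ext i
  simp

lemma lintegral_weightedSup_comp {P : Measure X} [IsProbabilityMeasure P]
    {𝓖 : Set (X → ℝ)} (h : PMeasurable P 𝓖) {ι : Type*} [Fintype ι] (σ : ι ≃ ι) (s : ι → ℝ)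
    (hs : ∀ i, s i = 1 ∨ s i = -1) :
    ∫⁻ z, weightedSup 𝓖 (s ∘ σ) z ∂(Measure.pi fun _ => P) =
      ∫⁻ z, weightedSup 𝓖 s z ∂(Measure.pi fun _ => P) := by
  have h1 := measurePreserving_comp_equiv_symm P σ
  have h2 := h.aemeasurable_weightedSup s hs
  rw [← h1.map_eq] at h2
  conv_rhs => rw [← h1.map_eq, lintegral_map' h2 h1.measurable.aemeasurable]
  simp_rw [weightedSup_comp_equiv_symm]

lemma weightedSup_neg {Y ι : Type*} [Fintype ι] (𝓖 : Set (Y → ℝ)) (s : ι → ℝ) (z : ι → Y) :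
    weightedSup 𝓖 (-s) z = weightedSup 𝓖 s z := by
  simp [weightedSup]

lemma weightedSup_sumElim_le {Y ι κ : Type*} [Fintype ι] [Fintype κ] (𝓖 : Set (Y → ℝ))
    (a : ι → ℝ) (b : κ → ℝ) (x : ι → Y) (y : κ → Y) :
    weightedSup 𝓖 (Sum.elim a b) (Sum.elim x y) ≤ weightedSup 𝓖 a x + weightedSup 𝓖 b y := by
  refine iSup₂_le fun g hg => ?_
  simp only [Fintype.sum_sum_type, Sum.elim_inl, Sum.elim_inr]
  calc ENNReal.ofReal |∑ i, a i * g (x i) + ∑ i, b i * g (y i)|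
      ≤ ENNReal.ofReal (|∑ i, a i * g (x i)| + |∑ i, b i * g (y i)|) :=
        ENNReal.ofReal_le_ofReal (abs_add_le _ _)
    _ = ENNReal.ofReal |∑ i, a i * g (x i)| + ENNReal.ofReal |∑ i, b i * g (y i)| :=
        ENNReal.ofReal_add (abs_nonneg _) (abs_nonneg _)
    _ ≤ _ := add_le_add
        (le_iSup₂ (f := fun (g : Y → ℝ) (_ : g ∈ 𝓖) => ENNReal.ofReal |∑ i, a i * g (x i)|) g hg)
        (le_iSup₂ (f := fun (g : Y → ℝ) (_ : g ∈ 𝓖) => ENNReal.ofReal |∑ i, b i * g (y i)|) g hg)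

lemma measurePreserving_sumElim {ι κ : Type*} [Fintype ι] [Fintype κ] (P : Measure X)
    [SigmaFinite P] :
    MeasurePreserving (fun w : (ι → X) × (κ → X) => (Sum.elim w.1 w.2 : ι ⊕ κ → X))
      ((Measure.pi fun _ => P).prod (Measure.pi fun _ => P)) (Measure.pi fun _ => P) := by
  have h := measurePreserving_sumPiEquivProdPi_symm (fun _ : ι ⊕ κ => P)
  have heq : ((MeasurableEquiv.sumPiEquivProdPi fun _ : ι ⊕ κ => X).symm :
      (ι → X) × (κ → X) → ι ⊕ κ → X) = fun w => Sum.elim w.1 w.2 := by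
    ext w k
    rcases k with k | k <;> rfl
  rwa [heq] at h

/-- Exchanging X_i with its independent copy wherever e_i = -1 preserves the law and turns the signs
(1, -1) into (e, -e); the triangle inequality then separates the two samples. -/
lemma weightedSup_const_one_neg_one_le {P : Measure X} [IsProbabilityMeasure P]
    {𝓖 : Set (X → ℝ)} (h : PMeasurable P 𝓖) {n : ℕ} (e : Fin n → Bool) :
    ∫⁻ z, weightedSup 𝓖 (Sum.elim (fun _ : Fin n => 1) (fun _ : Fin n => -1)) z
        ∂(Measure.pi fun _ => P) ≤
      2 * ∫⁻ x, weightedSup 𝓖 (fun i => sign (e i)) x ∂(Measure.pi fun _ => P) := by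
  let flip : Fin n ⊕ Fin n → Fin n ⊕ Fin n :=
    Sum.elim (fun i => if e i then Sum.inl i else Sum.inr i)
      (fun i => if e i then Sum.inr i else Sum.inl i)
  have hflip : Function.Involutive flip := by
    rintro (i | i) <;> by_cases hi : e i <;> simp [flip, hi]
  have hs : Sum.elim (fun _ : Fin n => (1 : ℝ)) (fun _ : Fin n => -1) ∘ hflip.toPerm =
      Sum.elim (fun i => sign (e i)) (-fun i => sign (e i)) := by
    ext i
    rcases i with i | i <;> by_cases hi : e i <;> simp [flip, hi, sign]
  have hpm : ∀ i : Fin n ⊕ Fin n,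
      Sum.elim (fun _ : Fin n => (1 : ℝ)) (fun _ : Fin n => -1) i = 1 ∨
      Sum.elim (fun _ : Fin n => (1 : ℝ)) (fun _ : Fin n => -1) i = -1 := by
    rintro (i | i) <;> simp
  have hpm' : ∀ i : Fin n ⊕ Fin n,
      Sum.elim (fun i => sign (e i)) (-fun i => sign (e i)) i = 1 ∨
      Sum.elim (fun i => sign (e i)) (-fun i => sign (e i)) i = -1 := by
    rintro (i | i) <;> by_cases hi : e i <;> simp [hi, sign]
  have hmeas := h.aemeasurable_weightedSup (fun i => sign (e i)) (fun i => sign_eq (e i))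
  have hmp := measurePreserving_sumElim (ι := Fin n) (κ := Fin n) P
  rw [← lintegral_weightedSup_comp h hflip.toPerm _ hpm, hs]
  have hm2 := h.aemeasurable_weightedSup _ hpm'
  rw [← hmp.map_eq] at hm2 ⊢
  rw [lintegral_map' hm2 hmp.measurable.aemeasurable]
  calc _ ≤ ∫⁻ w : (Fin n → X) × (Fin n → X), (weightedSup 𝓖 (fun i => sign (e i)) w.1 +
          weightedSup 𝓖 (fun i => sign (e i)) w.2)
          ∂((Measure.pi fun _ => P).prod (Measure.pi fun _ => P)) := by
        refine lintegral_mono fun w => ?_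
        refine (weightedSup_sumElim_le 𝓖 _ _ w.1 w.2).trans (le_of_eq ?_)
        rw [weightedSup_neg]
    _ = _ := by
        have h1 := measurePreserving_fst (μ := Measure.pi fun _ : Fin n => P)
          (ν := Measure.pi fun _ : Fin n => P)
        have h2 := measurePreserving_snd (μ := Measure.pi fun _ : Fin n => P)
          (ν := Measure.pi fun _ : Fin n => P)
        have hmeas1 : AEMeasurable (fun w : (Fin n → X) × (Fin n → X) =>
            weightedSup 𝓖 (fun i => sign (e i)) w.1)
            ((Measure.pi fun _ => P).prod (Measure.pi fun _ => P)) :=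
          hmeas.comp_quasiMeasurePreserving h1.quasiMeasurePreserving
        rw [lintegral_add_left' hmeas1, two_mul]
        congr 1
        · conv_rhs => rw [← h1.map_eq]
          rw [lintegral_map' (by rwa [h1.map_eq]) h1.measurable.aemeasurable]
        · conv_rhs => rw [← h2.map_eq]
          rw [lintegral_map' (by rwa [h2.map_eq]) h2.measurable.aemeasurable]

/-- The left side does not depend on e, so the bound for each fixed e may be averaged. -/
lemma PMeasurable.lintegral_weightedSup_le {P : Measure X} [IsProbabilityMeasure P]
    {𝓖 : Set (X → ℝ)} (h : PMeasurable P 𝓖) (n : ℕ) :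
    ∫⁻ z, weightedSup 𝓖 (Sum.elim (fun _ : Fin n => 1) (fun _ : Fin n => -1)) z
        ∂(Measure.pi fun _ => P) ≤
      2 * ∫⁻ x : Fin n → X, rademacherSup 𝓖 x ∂(Measure.pi fun _ => P) := by
  have hmeas : ∀ e : Fin n → Bool, AEMeasurable (weightedSup 𝓖 fun i => sign (e i))
    (Measure.pi fun _ => P) := fun e =>
      h.aemeasurable_weightedSup (fun i => sign (e i)) (fun i => sign_eq (e i))
  have h1 : ∫⁻ x : Fin n → X, rademacherSup 𝓖 x ∂(Measure.pi fun _ => P) =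
      (2 ^ n)⁻¹ * ∑ e : Fin n → Bool,
        ∫⁻ x, weightedSup 𝓖 (fun i => sign (e i)) x ∂(Measure.pi fun _ => P) := by
    rw [← lintegral_finsetSum' _ fun e _ => hmeas e]
    rw [← lintegral_const_mul' _ _ (by simp)]
    rfl
  set I := ∫⁻ z, weightedSup 𝓖 (Sum.elim (fun _ : Fin n => 1) (fun _ : Fin n => -1)) z
        ∂(Measure.pi fun _ => P)
  rw [h1]
  calc I = (2 ^ n)⁻¹ * ∑ _e : Fin n → Bool, I := by
        simp only [Finset.sum_const, Finset.card_univ, Fintype.card_fun, Fintype.card_bool,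
          Fintype.card_fin, nsmul_eq_mul, Nat.cast_pow, Nat.cast_ofNat]
        rw [← mul_assoc, ENNReal.inv_mul_cancel (by positivity) (by finiteness), one_mul]
    _ ≤ (2 ^ n)⁻¹ * ∑ e : Fin n → Bool,
        2 * ∫⁻ x, weightedSup 𝓖 (fun i => sign (e i)) x ∂(Measure.pi fun _ => P) := by
        gcongr with e
        exact weightedSup_const_one_neg_one_le h e
    _ = _ := by
        rw [← Finset.mul_sum]; ring

/-- Outer expectations require a majorant that is measurable and valid everywhere: take the
measurable version and add ∞ on a measurable null set containing the exceptional points. -/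
lemma exists_measurable_ge_lintegral_eq {Ω : Type*} [MeasurableSpace Ω] {μ : Measure Ω}
    {T : Ω → ℝ≥0∞} (hT : AEMeasurable T μ) :
    ∃ U, Measurable U ∧ (∀ ω, T ω ≤ U ω) ∧ ∫⁻ ω, U ω ∂μ = ∫⁻ ω, T ω ∂μ := by
  have hnull : μ {ω | T ω ≠ hT.mk T ω} = 0 := hT.ae_eq_mk
  set N := toMeasurable μ {ω | T ω ≠ hT.mk T ω}
  have hN0 : μ N = 0 := by rw [measure_toMeasurable, hnull]
  refine ⟨fun ω => hT.mk T ω + N.indicator (fun _ => ⊤) ω,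
    hT.measurable_mk.add (measurable_const.indicator (measurableSet_toMeasurable _ _)),
    fun ω => ?_, ?_⟩
  · by_cases hω : T ω = hT.mk T ω
    · exact hω.le.trans le_self_add
    · have : ω ∈ N := subset_toMeasurable μ {ω | T ω ≠ hT.mk T ω} hω
      simp [this]
  · rw [lintegral_add_left hT.measurable_mk,
      lintegral_indicator (measurableSet_toMeasurable _ _), setLIntegral_const, hN0, mul_zero,
      add_zero]
    exact lintegral_congr_ae hT.ae_eq_mk.symm

/-- Replacing the means by an independent copy of the sample. -/
lemma empiricalSup_le_lintegral {P : Measure X} [IsProbabilityMeasure P] {𝓖 : Set (X → ℝ)}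
    (h𝓖 : ∀ g ∈ 𝓖, Integrable g P) {n : ℕ} (x : Fin n → X) :
    empiricalSup P 𝓖 x ≤ ENNReal.ofReal (Real.sqrt n)⁻¹ *
      ∫⁻ y, weightedSup 𝓖 (Sum.elim (fun _ : Fin n => 1) (fun _ : Fin n => -1)) (Sum.elim x y)
        ∂(Measure.pi fun _ : Fin n => P) := by
  refine iSup₂_le fun g hg => ?_
  rw [empProc, abs_mul, abs_of_nonneg (by positivity), ENNReal.ofReal_mul (by positivity)]
  gcongr
  have hint : ∀ i : Fin n, Integrable (fun y : Fin n → X => g (y i)) (Measure.pi fun _ => P) :=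
    fun i => integrable_comp_eval (h𝓖 g hg)
  have h1 : ∑ i, (g (x i) - ∫ y, g y ∂P) =
      ∫ y, ∑ i, (g (x i) - g (y i)) ∂(Measure.pi fun _ : Fin n => P) := by
    have hsub : ∀ i ∈ Finset.univ, Integrable (fun y : Fin n → X => g (x i) - g (y i))
      (Measure.pi fun _ => P) := fun i _ => (integrable_const _).sub (hint i)
    rw [integral_finsetSum _ hsub]
    refine Finset.sum_congr rfl fun i _ => ?_
    rw [integral_sub (integrable_const _) (hint i),
      integral_comp_eval (μ := fun _ : Fin n => P) (h𝓖 g hg).aestronglyMeasurable]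
    simp
  rw [h1, ← Real.enorm_eq_ofReal_abs]
  refine (enorm_integral_le_lintegral_enorm _).trans (lintegral_mono fun y => ?_)
  rw [Real.enorm_eq_ofReal_abs]
  refine le_trans (le_of_eq ?_) (le_iSup₂ (f := fun (g : X → ℝ) (_ : g ∈ 𝓖) => ENNReal.ofReal
    |∑ i, Sum.elim (fun _ : Fin n => (1 : ℝ)) (fun _ : Fin n => -1) i * g (Sum.elim x y i)|) g hg)
  simp [Fintype.sum_sum_type, Finset.sum_add_distrib, sub_eq_add_neg]

/-- Symmetrization. -/
lemma PMeasurable.outerExpectation_empiricalSup_le {P : Measure X} [IsProbabilityMeasure P]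
    {𝓖 : Set (X → ℝ)} (h : PMeasurable P 𝓖) (h𝓖 : ∀ g ∈ 𝓖, Integrable g P) (n : ℕ) :
    outerExpectation (Measure.pi fun _ : Fin n => P) (empiricalSup P 𝓖) ≤
      ENNReal.ofReal (Real.sqrt n)⁻¹ *
        (2 * ∫⁻ x : Fin n → X, rademacherSup 𝓖 x ∂(Measure.pi fun _ => P)) := by
  have hpm : ∀ i : Fin n ⊕ Fin n,
      Sum.elim (fun _ : Fin n => (1 : ℝ)) (fun _ : Fin n => -1) i = 1 ∨
      Sum.elim (fun _ : Fin n => (1 : ℝ)) (fun _ : Fin n => -1) i = -1 := by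
    rintro (i | i) <;> simp
  obtain ⟨U, hU, hle, hint⟩ := exists_measurable_ge_lintegral_eq (h.aemeasurable_weightedSup _ hpm)
  have hmp := measurePreserving_sumElim (ι := Fin n) (κ := Fin n) P
  have hU' : Measurable fun w : (Fin n → X) × (Fin n → X) => U (Sum.elim w.1 w.2) :=
    hU.comp hmp.measurable
  calc outerExpectation (Measure.pi fun _ : Fin n => P) (empiricalSup P 𝓖)
      ≤ ∫⁻ x, ENNReal.ofReal (Real.sqrt n)⁻¹ *
          ∫⁻ y, U (Sum.elim x y) ∂(Measure.pi fun _ : Fin n => P)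
            ∂(Measure.pi fun _ : Fin n => P) := by
        -- Joint measurability of U makes its partial integral over the copy an admissible majorant.
        refine iInf_le_of_le _ (iInf_le_of_le (hU'.lintegral_prod_right'.const_mul _)
          (iInf_le_of_le (fun x => ?_) le_rfl))
        refine (empiricalSup_le_lintegral h𝓖 x).trans ?_
        gcongr
        exact hle _
    _ = ENNReal.ofReal (Real.sqrt n)⁻¹ * ∫⁻ z, U z ∂(Measure.pi fun _ => P) := by
        rw [lintegral_const_mul _ hU'.lintegral_prod_right', ← hmp.map_eq,
          lintegral_map hU hmp.measurable, lintegral_prod _ hU'.aemeasurable]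
    _ ≤ _ := by
        rw [hint]
        gcongr
        exact h.lintegral_weightedSup_le n

/-! ### Means over the sample -/

lemma sum_enorm_sq_eq {n : ℕ} (v : Fin n → ℝ) :
    ∑ i, ‖v i‖ₑ ^ 2 = ENNReal.ofReal (∑ i, v i ^ 2) := by
  rw [ENNReal.ofReal_sum_of_nonneg fun i _ => sq_nonneg _]
  refine Finset.sum_congr rfl fun i _ => ?_
  rw [← enorm_pow, Real.enorm_of_nonneg (sq_nonneg _)]

/-- This is `PMeasurable` for the squares with all signs equal to 1. -/
lemma PMeasurable.aemeasurable_supSumSq {P : Measure X} [IsProbabilityMeasure P]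
    {𝓕 : Set (X → ℝ)} (h : PMeasurable P (powClass 𝓕 2)) (n : ℕ) :
    AEMeasurable (fun x : Fin n → X => supSumSq 𝓕 x) (Measure.pi fun _ => P) := by
  refine (h.aemeasurable_weightedSup (fun _ : Fin n => 1) fun _ => Or.inl rfl).congr
    (Filter.Eventually.of_forall fun x => ?_)
  simp only [weightedSup, supSumSq, powClass, iSup_image]
  refine iSup_congr fun f => iSup_congr fun _ => ?_
  simp only [one_mul]
  rw [sum_enorm_sq_eq fun i => f (x i),
    abs_of_nonneg (Finset.sum_nonneg fun i _ => sq_nonneg (f (x i)))]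

lemma lintegral_sum_eval {P : Measure X} [IsProbabilityMeasure P] {n : ℕ} {h : X → ℝ≥0∞}
    (hh : Measurable h) :
    ∫⁻ x : Fin n → X, ∑ i, h (x i) ∂(Measure.pi fun _ => P) = n * ∫⁻ y, h y ∂P := by
  rw [lintegral_finsetSum _ fun i _ => by fun_prop]
  have : ∀ i : Fin n, ∫⁻ x : Fin n → X, h (x i) ∂(Measure.pi fun _ => P) = ∫⁻ y, h y ∂P := by
    intro i
    have hmp := measurePreserving_eval (fun _ : Fin n => P) i
    exact hmp.lintegral_comp hh
  simp [this]

/-- Jensen's inequality for the square root, as Hölder's inequality against the constant 1. -/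
lemma lintegral_rpow_half_le {Ω : Type*} [MeasurableSpace Ω] {μ : Measure Ω}
    [IsProbabilityMeasure μ] {h : Ω → ℝ≥0∞} (hh : AEMeasurable h μ) :
    ∫⁻ ω, h ω ^ (1 / 2 : ℝ) ∂μ ≤ (∫⁻ ω, h ω ∂μ) ^ (1 / 2 : ℝ) := by
  have := ENNReal.lintegral_mul_norm_pow_le (μ := μ) hh (aemeasurable_const (b := (1 : ℝ≥0∞)))
    (p := 1 / 2) (q := 1 / 2) (by norm_num) (by norm_num) (by norm_num)
  simpa using this

lemma lintegral_rpow_mul_rpow_half_le {Ω : Type*} [MeasurableSpace Ω] {μ : Measure Ω}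
    [IsProbabilityMeasure μ] {g h : Ω → ℝ≥0∞} (hg : AEMeasurable g μ) (hh : AEMeasurable h μ)
    {r : ℝ} (hr0 : 0 ≤ r) (hr1 : r ≤ 1) :
    ∫⁻ ω, (g ω ^ r * h ω ^ (1 - r)) ^ (1 / 2 : ℝ) ∂μ ≤
      ((∫⁻ ω, g ω ∂μ) ^ r * (∫⁻ ω, h ω ∂μ) ^ (1 - r)) ^ (1 / 2 : ℝ) := by
  refine (lintegral_rpow_half_le (by fun_prop)).trans ?_
  gcongr
  exact ENNReal.lintegral_mul_norm_pow_le hg hh hr0 (by linarith) (by ring)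

lemma lintegral_const_mul_add_div {Ω : Type*} [MeasurableSpace Ω] {μ : Measure Ω} (c d : ℝ≥0∞)
    {g h : Ω → ℝ≥0∞} (hg : AEMeasurable g μ) (hh : AEMeasurable h μ) :
    ∫⁻ ω, c * (g ω + h ω / d) ∂μ = c * (∫⁻ ω, g ω ∂μ + (∫⁻ ω, h ω ∂μ) / d) := by
  have hsum : AEMeasurable (fun ω => g ω + h ω * d⁻¹) μ := hg.add (hh.mul_const _)
  simp only [div_eq_mul_inv]
  rw [lintegral_const_mul'' _ hsum, lintegral_add_left' hg, lintegral_mul_const'' _ hh]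

/-- Mean form of `rademacherSup_le`. -/
lemma lintegral_rademacherSup_le {P : Measure X} [IsProbabilityMeasure P] {n : ℕ} (hn : 1 ≤ n)
    {𝓕 : Set (X → ℝ)} {F : X → ℝ} (h𝓕 : ∀ f ∈ 𝓕, Measurable f) (hF : IsEnvelope F 𝓕)
    (h2 : PMeasurable P (powClass 𝓕 2)) {t : ℝ} (ht : 0 < t) :
    ∫⁻ x : Fin n → X, rademacherSup 𝓕 x ∂(Measure.pi fun _ => P) ≤
      12 * uniformEntropyIntegral t 𝓕 F 2 * ((n * ∫⁻ y, ‖F y‖ₑ ^ 2 ∂P) ^ (1 / 2 : ℝ) +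
        (∫⁻ x : Fin n → X, supSumSq 𝓕 x ∂(Measure.pi fun _ => P)) ^ (1 / 2 : ℝ) /
          ENNReal.ofReal t) := by
  have hS := h2.aemeasurable_supSumSq n
  have hFm := hF.1
  have hA : Measurable fun x : Fin n → X => ∑ i, ‖F (x i)‖ₑ ^ 2 := by fun_prop
  refine (lintegral_mono fun x => rademacherSup_le hn h𝓕 hF x ht).trans ?_
  rw [lintegral_const_mul_add_div _ _ (hA.aemeasurable.pow_const _) (hS.pow_const _)]
  gcongr
  · refine (lintegral_rpow_half_le hA.aemeasurable).trans ?_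
    rw [lintegral_sum_eval (h := fun y => ‖F y‖ₑ ^ 2) (by fun_prop)]
  · exact lintegral_rpow_half_le hS

/-- Mean form of `rademacherSup_powClass_two_le`. -/
lemma lintegral_rademacherSup_powClass_two_le {P : Measure X} [IsProbabilityMeasure P] {n : ℕ}
    {𝓕 : Set (X → ℝ)} {F : X → ℝ} (h𝓕 : ∀ f ∈ 𝓕, Measurable f) (hF : IsEnvelope F 𝓕)
    (h2 : PMeasurable P (powClass 𝓕 2)) {p t : ℝ} (hp : 1 < p) (ht : 0 < t) :
    ∫⁻ x : Fin n → X, rademacherSup (powClass 𝓕 2) x ∂(Measure.pi fun _ => P) ≤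
      12 * uniformEntropyIntegral t 𝓕 F 2 * (2 * ((n * ∫⁻ y, ‖F y‖ₑ ^ 2 ∂P) ^ (1 / p) *
          (n * ∫⁻ y, ‖F y‖ₑ ^ ((4 * p - 2) / (p - 1)) ∂P) ^ (1 - 1 / p)) ^ (1 / 2 : ℝ) +
        ((∫⁻ x : Fin n → X, supSumSq 𝓕 x ∂(Measure.pi fun _ => P)) ^ (1 / p) *
          (n * ∫⁻ y, ‖F y‖ₑ ^ ((4 * p - 2) / (p - 1)) ∂P) ^ (1 - 1 / p)) ^ (1 / 2 : ℝ) /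
          ENNReal.ofReal t) := by
  have hr0 : 0 ≤ 1 / p := by positivity
  have hr1 : 1 / p ≤ 1 := (div_le_one (by linarith)).2 hp.le
  have hS := h2.aemeasurable_supSumSq n
  have hFm := hF.1
  have hA : Measurable fun x : Fin n → X => ∑ i, ‖F (x i)‖ₑ ^ 2 := by fun_prop
  have hB : Measurable fun x : Fin n → X => ∑ i, ‖F (x i)‖ₑ ^ ((4 * p - 2) / (p - 1)) := by
    fun_prop
  refine (lintegral_mono fun x => rademacherSup_powClass_two_le h𝓕 hF x hp ht).trans ?_
  have hAB : Measurable fun x : Fin n → X => ((∑ i, ‖F (x i)‖ₑ ^ 2) ^ (1 / p) *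
      (∑ i, ‖F (x i)‖ₑ ^ ((4 * p - 2) / (p - 1))) ^ (1 - 1 / p)) ^ (1 / 2 : ℝ) :=
    ((hA.pow_const _).mul (hB.pow_const _)).pow_const _
  have hSB : AEMeasurable (fun x : Fin n → X => (supSumSq 𝓕 x ^ (1 / p) *
      (∑ i, ‖F (x i)‖ₑ ^ ((4 * p - 2) / (p - 1))) ^ (1 - 1 / p)) ^ (1 / 2 : ℝ))
      (Measure.pi fun _ => P) :=
    ((hS.pow_const _).mul (hB.aemeasurable.pow_const _)).pow_const _
  rw [lintegral_const_mul_add_div _ _ (hAB.const_mul _).aemeasurable hSB,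
    lintegral_const_mul _ hAB,
    ← lintegral_sum_eval (h := fun y => ‖F y‖ₑ ^ 2) (by fun_prop),
    ← lintegral_sum_eval (h := fun y => ‖F y‖ₑ ^ ((4 * p - 2) / (p - 1))) (by fun_prop)]
  gcongr
  · exact lintegral_rpow_mul_rpow_half_le hA.aemeasurable hB.aemeasurable hr0 hr1
  · exact lintegral_rpow_mul_rpow_half_le hS hB.aemeasurable hr0 hr1

/-- The mean of the supremum of sums of squares is controlled by the empirical process indexed by
the squares. -/
lemma lintegral_supSumSq_le {P : Measure X} [IsProbabilityMeasure P] {n : ℕ} (hn : 1 ≤ n)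
    {𝓕 : Set (X → ℝ)} {M : ℝ≥0∞}
    (h : ∀ f ∈ 𝓕, ENNReal.ofReal (∫ y, f y ^ 2 ∂P) ≤ M) :
    ∫⁻ x : Fin n → X, supSumSq 𝓕 x ∂(Measure.pi fun _ => P) ≤
      n * M + ENNReal.ofReal (Real.sqrt n) *
        outerExpectation (Measure.pi fun _ : Fin n => P) (empiricalSup P (powClass 𝓕 2)) := by
  have hn0 : (0 : ℝ) < n := by exact_mod_cast hn
  have hsq : (0 : ℝ) < Real.sqrt n := Real.sqrt_pos.2 hn0
  have hpt : ∀ x : Fin n → X, supSumSq 𝓕 x ≤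
      n * M + ENNReal.ofReal (Real.sqrt n) * empiricalSup P (powClass 𝓕 2) x := by
    intro x
    refine iSup₂_le fun f hf => ?_
    rw [sum_enorm_sq_eq fun i => f (x i)]
    have h1 : ∑ i, f (x i) ^ 2 = n * ∫ y, f y ^ 2 ∂P +
        Real.sqrt n * empProc P x (fun y => f y ^ 2) := by
      rw [empProc, mul_inv_cancel_left₀ hsq.ne', Finset.sum_sub_distrib]
      simp
    have h2 : ∑ i, f (x i) ^ 2 ≤ n * ∫ y, f y ^ 2 ∂P +
        Real.sqrt n * |empProc P x (fun y => f y ^ 2)| := by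
      rw [h1]; gcongr; exact le_abs_self _
    refine (ENNReal.ofReal_le_ofReal h2).trans (ENNReal.ofReal_add_le.trans ?_)
    rw [ENNReal.ofReal_mul hn0.le, ENNReal.ofReal_mul hsq.le, ENNReal.ofReal_natCast]
    gcongr
    · exact h f hf
    · exact le_iSup₂ (f := fun (g : X → ℝ) (_ : g ∈ powClass 𝓕 2) =>
        ENNReal.ofReal |empProc P x g|) (fun y => f y ^ 2) ⟨f, hf, rfl⟩
  -- The outer expectation is isolated because it is an infimum: a lower bound can be checked for
  -- each majorant U.
  have key : (∫⁻ x : Fin n → X, supSumSq 𝓕 x ∂(Measure.pi fun _ => P) - n * M) /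
      ENNReal.ofReal (Real.sqrt n) ≤
        outerExpectation (Measure.pi fun _ : Fin n => P) (empiricalSup P (powClass 𝓕 2)) := by
    refine le_iInf fun U => le_iInf fun hU => le_iInf fun hle => ?_
    refine ENNReal.div_le_of_le_mul' (tsub_le_iff_left.2 ?_)
    calc ∫⁻ x : Fin n → X, supSumSq 𝓕 x ∂(Measure.pi fun _ => P)
        ≤ ∫⁻ x : Fin n → X, (n * M + ENNReal.ofReal (Real.sqrt n) * U x)
            ∂(Measure.pi fun _ => P) := by
          refine lintegral_mono fun x => (hpt x).trans ?_
          gcongr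
          exact hle x
      _ = _ := by
          rw [lintegral_add_left measurable_const, lintegral_const_mul _ hU]
          simp
  rw [ENNReal.div_le_iff_le_mul (Or.inl (by simpa using hn0)) (Or.inl ENNReal.ofReal_ne_top),
    tsub_le_iff_left] at key
  rwa [mul_comm (ENNReal.ofReal _)]

/-! ### The self-bounding inequality and its normalization -/

/-- Solving the inequality `Y ^ 2 ≤ 1 + c * Y ^ r * Z` for `Y`. -/
lemma le_of_sq_le_add_rpow {Y c Z : ℝ≥0∞} {r : ℝ} (hY : 1 ≤ Y) (hYtop : Y ≠ ⊤) (hc : 1 ≤ c)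
    (hr0 : 0 ≤ r) (hr1 : r ≤ 1) (h : Y ^ 2 ≤ 1 + c * Y ^ r * Z) :
    Y ≤ c * (1 + Z) ^ (2 - r)⁻¹ := by
  have hY0 : Y ≠ 0 := (zero_lt_one.trans_le hY).ne'
  have hYr : 1 ≤ Y ^ r := by
    simpa using ENNReal.rpow_le_rpow hY hr0
  -- Since c * Y ^ r ≥ 1, the summand 1 is absorbed and Y ^ r, which is finite and nonzero, cancels.
  have h1 : Y ^ r * Y ^ (2 - r) ≤ Y ^ r * (c * (1 + Z)) := by
    calc Y ^ r * Y ^ (2 - r) = Y ^ 2 := by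
          rw [← ENNReal.rpow_add _ _ hY0 hYtop, ← ENNReal.rpow_ofNat]; congr 1; ring
      _ ≤ 1 + c * Y ^ r * Z := h
      _ ≤ Y ^ r * c + c * Y ^ r * Z := by
          gcongr
          exact one_le_mul hYr hc
      _ = Y ^ r * (c * (1 + Z)) := by ring
  have h2 : Y ^ (2 - r) ≤ c * (1 + Z) := by
    rwa [ENNReal.mul_le_mul_iff_right (zero_lt_one.trans_le hYr).ne'
      (ENNReal.rpow_ne_top_of_nonneg hr0 hYtop)] at h1
  have hq : 0 < 2 - r := by linarith
  calc Y = (Y ^ (2 - r)) ^ (2 - r)⁻¹ := (ENNReal.rpow_rpow_inv hq.ne' Y).symm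
    _ ≤ (c * (1 + Z)) ^ (2 - r)⁻¹ := by gcongr
    _ = c ^ (2 - r)⁻¹ * (1 + Z) ^ (2 - r)⁻¹ := ENNReal.mul_rpow_of_nonneg _ _ (by positivity)
    _ ≤ c * (1 + Z) ^ (2 - r)⁻¹ := by
        gcongr
        conv_rhs => rw [← ENNReal.rpow_one c]
        exact ENNReal.rpow_le_rpow_of_exponent_le hc (inv_le_one_of_one_le₀ (by linarith))

lemma eLpNorm_rpow_eq_lintegral (F : X → ℝ) (P : Measure X) {R : ℝ} (hR : 0 < R) :
    eLpNorm F (ENNReal.ofReal R) P ^ R = ∫⁻ y, ‖F y‖ₑ ^ R ∂P := by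
  rw [eLpNorm_eq_lintegral_rpow_enorm_toReal (by simpa using hR) ENNReal.ofReal_ne_top,
    ENNReal.toReal_ofReal hR.le, one_div, ENNReal.rpow_inv_rpow hR.ne']

lemma eLpNorm_two_sq_eq_lintegral (F : X → ℝ) (P : Measure X) :
    eLpNorm F 2 P ^ 2 = ∫⁻ y, ‖F y‖ₑ ^ 2 ∂P := by
  have := eLpNorm_rpow_eq_lintegral F P two_pos
  simpa using this

/-- With S ≤ T²D, the extracted T ^ r cancels the division by t^{1/p} in the bound for the squares.
-/
lemma rpow_half_mul_rpow (T D E : ℝ≥0∞) {r : ℝ} (hr : 0 ≤ r) :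
    ((T ^ 2 * D) ^ r * E) ^ (1 / 2 : ℝ) = T ^ r * (D ^ r * E) ^ (1 / 2 : ℝ) := by
  rw [ENNReal.mul_rpow_of_nonneg _ _ hr, mul_assoc,
    ENNReal.mul_rpow_of_nonneg _ _ (by norm_num : (0 : ℝ) ≤ 1 / 2), ← ENNReal.rpow_ofNat,
    ← ENNReal.rpow_mul, ← ENNReal.rpow_mul]
  congr 2
  ring

lemma sq_mul_rpow_half (T D : ℝ≥0∞) : (T ^ 2 * D) ^ (1 / 2 : ℝ) = T * D ^ (1 / 2 : ℝ) := by
  simpa using rpow_half_mul_rpow T D 1 zero_le_one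

/-- Used with N = √n, A = ‖F‖_{P,2} and B = ‖F‖_{P,R}; the exponent of B comes from R(1 - 1/p) = 2(2
- 1/p). -/
lemma holder_factor_eq (N A B : ℝ≥0∞) {p : ℝ} (hp : 1 < p) :
    ((N ^ 2 * A ^ 2) ^ (1 / p) * (N ^ 2 * B ^ ((4 * p - 2) / (p - 1))) ^ (1 - 1 / p)) ^
      (1 / 2 : ℝ) = N * (A ^ (1 / p) * B ^ (2 - 1 / p)) := by
  have hp0 : 0 < p := by linarith
  have hp1 : p - 1 ≠ 0 := by linarith
  have hr0 : 0 ≤ 1 / p := by positivity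
  have hr1 : 0 ≤ 1 - 1 / p := sub_nonneg.2 ((div_le_one hp0).2 hp.le)
  have h1 : B ^ ((4 * p - 2) / (p - 1) * (1 - 1 / p)) = (B ^ (2 - 1 / p)) ^ 2 := by
    rw [← ENNReal.rpow_ofNat, ← ENNReal.rpow_mul]
    congr 1
    field_simp
    ring
  have h2 : (N ^ 2) ^ (1 / p) * (N ^ 2) ^ (1 - 1 / p) = N ^ 2 := by
    rw [← ENNReal.rpow_add_of_nonneg _ _ hr0 hr1, add_sub_cancel, ENNReal.rpow_one]
  have h3 : (A ^ 2) ^ (1 / p) = (A ^ (1 / p)) ^ 2 := by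
    rw [← ENNReal.rpow_ofNat, ← ENNReal.rpow_ofNat, ← ENNReal.rpow_mul, ← ENNReal.rpow_mul,
      mul_comm]
  have h4 : (N ^ 2 * A ^ 2) ^ (1 / p) *
      (N ^ 2 * B ^ ((4 * p - 2) / (p - 1))) ^ (1 - 1 / p) =
        (N * (A ^ (1 / p) * B ^ (2 - 1 / p))) ^ 2 * 1 := by
    rw [ENNReal.mul_rpow_of_nonneg _ _ hr0, ENNReal.mul_rpow_of_nonneg _ _ hr1,
      ← ENNReal.rpow_mul B, h1, h3]
    calc _ = ((N ^ 2) ^ (1 / p) * (N ^ 2) ^ (1 - 1 / p)) *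
          ((A ^ (1 / p)) ^ 2 * (B ^ (2 - 1 / p)) ^ 2) := by ring
      _ = _ := by rw [h2]; ring
  rw [h4, sq_mul_rpow_half]
  simp

/-- The entropy integral at `t` in terms of the one at `δ ≤ t`. -/
lemma uniformEntropyIntegral_le_two_mul (𝓕 : Set (X → ℝ)) (F : X → ℝ) {s t : ℝ} (hs : 0 < s)
    (hst : s ≤ t) :
    uniformEntropyIntegral t 𝓕 F 2 ≤
      2 * (ENNReal.ofReal t / ENNReal.ofReal s) * uniformEntropyIntegral s 𝓕 F 2 := by
  refine (uniformEntropyIntegral_le 𝓕 F 2 t hs).trans ?_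
  rw [two_mul]
  gcongr
  rw [ENNReal.le_div_iff_mul_le (Or.inl (by simpa using hs)) (Or.inl ENNReal.ofReal_ne_top),
    one_mul]
  exact ENNReal.ofReal_le_ofReal hst

/-! ### The maximal inequality -/

/-- The maximal inequality, for a nonempty class. -/
lemma outerExpectation_empiricalSup_le {P : Measure X} [IsProbabilityMeasure P]
    {𝓕 : Set (X → ℝ)} {F : X → ℝ} {p δ : ℝ} {n : ℕ} (hne : 𝓕.Nonempty)
    (h𝓕 : ∀ f ∈ 𝓕, Measurable f) (hF : IsEnvelope F 𝓕) (h1 : PMeasurable P 𝓕)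
    (h2 : PMeasurable P (powClass 𝓕 2)) (hp : 1 < p)
    (hB : eLpNorm F (ENNReal.ofReal ((4 * p - 2) / (p - 1))) P < ∞) (hδ : 0 < δ)
    (hvar : ∀ f ∈ 𝓕, ∫ x, f x ^ 2 ∂P < δ ^ 2 * ∫ x, F x ^ 2 ∂P) (hn : 1 ≤ n) :
    outerExpectation (Measure.pi fun _ : Fin n => P) (empiricalSup P 𝓕) ≤
        13824 * uniformEntropyIntegral δ 𝓕 F 2 *
          (1 + uniformEntropyIntegral (δ ^ (1 / p)) 𝓕 F 2 /
                ENNReal.ofReal (δ ^ 2 * Real.sqrt n) *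
              (eLpNorm F (ENNReal.ofReal ((4 * p - 2) / (p - 1))) P ^ (2 - 1 / p) /
                eLpNorm F 2 P ^ (2 - 1 / p))) ^ (p / (2 * p - 1)) *
          eLpNorm F 2 P := by
  have hp0 : 0 < p := by linarith
  have hr0 : 0 < 1 / p := by positivity
  have hr1 : 1 / p ≤ 1 := (div_le_one hp0).2 hp.le
  have hR2 : 4 ≤ (4 * p - 2) / (p - 1) := by
    rw [le_div_iff₀ (by linarith)]; linarith
  have hn0 : (0 : ℝ) < n := by exact_mod_cast hn
  have hsq : (0 : ℝ) < Real.sqrt n := Real.sqrt_pos.2 hn0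
  have hER := eLpNorm_rpow_eq_lintegral F P (show 0 < (4 * p - 2) / (p - 1) by linarith)
  have hE2 := eLpNorm_two_sq_eq_lintegral F P
  have hF4 : MemLp F 4 P := by
    refine MemLp.mono_exponent (q := ENNReal.ofReal ((4 * p - 2) / (p - 1)))
      ⟨hF.1.aestronglyMeasurable, hB⟩ ?_
    rw [show (4 : ℝ≥0∞) = ENNReal.ofReal 4 by simp]
    exact ENNReal.ofReal_le_ofReal hR2
  have hF2 : MemLp F 2 P := hF4.mono_exponent (by norm_num)
  have hA : eLpNorm F 2 P ≠ ⊤ := hF2.eLpNorm_ne_top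
  -- The strict variance bound, applied to some f, excludes a null envelope.
  have hA0 : eLpNorm F 2 P ≠ 0 := by
    intro h0
    obtain ⟨f, hf⟩ := hne
    have h3 := hvar f hf
    have h4 : F =ᵐ[P] 0 := (eLpNorm_eq_zero_iff hF.1.aestronglyMeasurable two_ne_zero).1 h0
    have h5 : ∫ x, F x ^ 2 ∂P = 0 := by
      refine integral_eq_zero_of_ae ?_
      filter_upwards [h4] with x hx
      simp [hx]
    rw [h5, mul_zero] at h3
    exact absurd h3 (not_lt.2 (integral_nonneg fun x => sq_nonneg _))
  have hL2 : ∀ f ∈ 𝓕, MemLp f 4 P := fun f hf =>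
    hF4.mono (h𝓕 f hf).aestronglyMeasurable (Filter.Eventually.of_forall fun y => by
      simpa using (hF.2 f hf y).trans (le_abs_self _))
  have hint1 : ∀ g ∈ 𝓕, Integrable g P := fun f hf => (hL2 f hf).integrable (by norm_num)
  have hint2 : ∀ g ∈ powClass 𝓕 2, Integrable g P := by
    rintro _ ⟨f, hf, rfl⟩
    exact ((hL2 f hf).mono_exponent (by norm_num : (2 : ℝ≥0∞) ≤ 4)).integrable_sq
  set A := eLpNorm F 2 P with hAdef
  set B := eLpNorm F (ENNReal.ofReal ((4 * p - 2) / (p - 1))) P with hBdef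
  set N := ENNReal.ofReal (Real.sqrt n) with hNdef
  set d := ENNReal.ofReal δ with hddef
  have hN0 : N ≠ 0 := by simpa [hNdef] using hn0
  have hNtop : N ≠ ⊤ := ENNReal.ofReal_ne_top
  have hd0 : d ≠ 0 := by simpa [hddef] using hδ
  have hdtop : d ≠ ⊤ := ENNReal.ofReal_ne_top
  have hN2 : (n : ℝ≥0∞) = N ^ 2 := by
    rw [hNdef, ← ENNReal.ofReal_pow hsq.le, Real.sq_sqrt hn0.le, ENNReal.ofReal_natCast]
  have hM : ∀ f ∈ 𝓕, ENNReal.ofReal (∫ y, f y ^ 2 ∂P) ≤ d ^ 2 * A ^ 2 := by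
    intro f hf
    refine (ENNReal.ofReal_le_ofReal (hvar f hf).le).trans ?_
    rw [ENNReal.ofReal_mul (by positivity), ENNReal.ofReal_pow hδ.le]
    gcongr
    rw [hE2, ← Real.enorm_of_nonneg (integral_nonneg fun x => sq_nonneg _)]
    refine (enorm_integral_le_lintegral_enorm _).trans (le_of_eq ?_)
    simp_rw [enorm_pow]
  set S := ∫⁻ x : Fin n → X, supSumSq 𝓕 x ∂(Measure.pi fun _ => P) with hSdef
  set D := N ^ 2 * A ^ 2 with hD
  have hD0 : D ≠ 0 := by positivity
  have hDtop : D ≠ ⊤ := by finiteness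
  have hSD : S ≤ D := by
    have hFm := hF.1
    rw [hD, ← hN2, hE2, ← lintegral_sum_eval (h := fun y => ‖F y‖ₑ ^ 2) (by fun_prop)]
    exact lintegral_mono fun x => supSumSq_le hF x
  -- the radius
  obtain ⟨t, hδt, hST, hTS⟩ : ∃ t : ℝ, δ ≤ t ∧ S ≤ ENNReal.ofReal t ^ 2 * D ∧
      (ENNReal.ofReal t ^ 2 * D ≤ S ∨ t = δ) := by
    -- The choice is t = max(δ, √(S/D)).
    rcases le_total S (d ^ 2 * D) with h | h
    · exact ⟨δ, le_rfl, h, Or.inr rfl⟩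
    · have hfin : S / D ≠ ⊤ := ENNReal.div_ne_top (ne_top_of_le_ne_top hDtop hSD) hD0
      have h3 : ENNReal.ofReal (Real.sqrt (S / D).toReal) ^ 2 * D = S := by
        rw [← ENNReal.ofReal_pow (Real.sqrt_nonneg _), Real.sq_sqrt ENNReal.toReal_nonneg,
          ENNReal.ofReal_toReal hfin, ENNReal.div_mul_cancel hD0 hDtop]
      refine ⟨Real.sqrt (S / D).toReal, ?_, h3.ge, Or.inl h3.le⟩
      refine Real.le_sqrt_of_sq_le ?_
      rw [← ENNReal.ofReal_le_iff_le_toReal hfin, ENNReal.ofReal_pow hδ.le,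
        ENNReal.le_div_iff_mul_le (Or.inl hD0) (Or.inl hDtop)]
      exact h
  have ht : 0 < t := hδ.trans_le hδt
  set T := ENNReal.ofReal t with hTdef
  have hTtop : T ≠ ⊤ := ENNReal.ofReal_ne_top
  have hTr : ENNReal.ofReal (t ^ (1 / p)) = T ^ (1 / p) := by
    rw [hTdef, ENNReal.ofReal_rpow_of_pos ht]
  have hdr : ENNReal.ofReal (δ ^ (1 / p)) = d ^ (1 / p) := by
    rw [hddef, ENNReal.ofReal_rpow_of_pos hδ]
  set L := N * (A ^ (1 / p) * B ^ (2 - 1 / p)) with hL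
  set J := uniformEntropyIntegral δ 𝓕 F 2
  set J' := uniformEntropyIntegral (δ ^ (1 / p)) 𝓕 F 2
  set Y := T / d with hY
  have hY1 : 1 ≤ Y := by
    rw [hY, ENNReal.le_div_iff_mul_le (Or.inl hd0) (Or.inl hdtop), one_mul]
    exact ENNReal.ofReal_le_ofReal hδt
  have hYtop : Y ≠ ⊤ := ENNReal.div_ne_top hTtop hd0
  have hYr : T ^ (1 / p) / d ^ (1 / p) = Y ^ (1 / p) :=
    (ENNReal.div_rpow_of_nonneg _ _ hr0.le).symm
  have hYd : Y * d = T := ENNReal.div_mul_cancel hd0 hdtop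
  -- the class of squares
  have hI2 : ∫⁻ x : Fin n → X, rademacherSup (powClass 𝓕 2) x ∂(Measure.pi fun _ => P) ≤
      72 * Y ^ (1 / p) * (J' * L) := by
    refine (lintegral_rademacherSup_powClass_two_le h𝓕 hF h2 hp
      (Real.rpow_pos_of_pos ht (1 / p))).trans ?_
    rw [← hE2, ← hER, ← hSdef, hN2, ← hD, hTr]
    -- Evaluating the entropy at t^{1/p} makes both terms of the bound multiples of L: 2L and at
    -- most L, whence 72 = 12 · 2 · 3.
    have h3 : (S ^ (1 / p) * (N ^ 2 * B ^ ((4 * p - 2) / (p - 1))) ^ (1 - 1 / p)) ^ (1 / 2 : ℝ) /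
        T ^ (1 / p) ≤ L := by
      refine ENNReal.div_le_of_le_mul' ?_
      rw [hL, ← holder_factor_eq N A B hp, ← hD, ← rpow_half_mul_rpow _ _ _ hr0.le]
      gcongr
    have h4 : (D ^ (1 / p) * (N ^ 2 * B ^ ((4 * p - 2) / (p - 1))) ^ (1 - 1 / p)) ^ (1 / 2 : ℝ) =
        L := by rw [hD, holder_factor_eq N A B hp]
    have h5 : uniformEntropyIntegral (t ^ (1 / p)) 𝓕 F 2 ≤ 2 * Y ^ (1 / p) * J' := by
      rw [← hYr, ← hTr, ← hdr]
      exact uniformEntropyIntegral_le_two_mul 𝓕 F (Real.rpow_pos_of_pos hδ _)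
        (Real.rpow_le_rpow hδ.le hδt hr0.le)
    rw [h4]
    calc _ ≤ 12 * (2 * Y ^ (1 / p) * J') * (2 * L + L) := by gcongr
      _ = _ := by ring
  have hout2 := h2.outerExpectation_empiricalSup_le hint2 n
  have hNinv : ENNReal.ofReal (Real.sqrt n)⁻¹ = N⁻¹ := ENNReal.ofReal_inv_of_pos hsq
  rw [hNinv] at hout2
  have hS2 : S ≤ d ^ 2 * D + 144 * Y ^ (1 / p) * (J' * L) := by
    refine (lintegral_supSumSq_le hn hM).trans ?_
    rw [hN2]
    refine add_le_add (le_of_eq (by rw [hD]; ring)) ?_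
    calc _ ≤ N * (N⁻¹ * (2 * (72 * Y ^ (1 / p) * (J' * L)))) := by
          gcongr
          exact hout2.trans (by gcongr)
      _ = (N * N⁻¹) * (144 * Y ^ (1 / p) * (J' * L)) := by ring
      _ = _ := by rw [ENNReal.mul_inv_cancel hN0 hNtop, one_mul]
  have hTD : T ^ 2 * D ≤ d ^ 2 * D + 144 * Y ^ (1 / p) * (J' * L) := by
    rcases hTS with h | h
    · exact h.trans hS2
    · rw [hTdef, h]; exact le_self_add
  set Z := J' / ENNReal.ofReal (δ ^ 2 * Real.sqrt n) * (B ^ (2 - 1 / p) / A ^ (2 - 1 / p)) with hZ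
  -- Z is L times the entropy integral, measured in units of δ²D; dividing by δ²D gives the
  -- inequality for Y.
  have hZL : J' * L = Z * (d ^ 2 * D) := by
    have hAr : A ^ 2 = A ^ (1 / p) * A ^ (2 - 1 / p) := by
      rw [← ENNReal.rpow_add _ _ hA0 hA, ← ENNReal.rpow_ofNat]; congr 1; ring
    have hAr0 : A ^ (2 - 1 / p) ≠ 0 := by simp [hA0, hA]
    have hArtop : A ^ (2 - 1 / p) ≠ ⊤ := ENNReal.rpow_ne_top_of_nonneg (by linarith) hA
    have hdN : ENNReal.ofReal (δ ^ 2 * Real.sqrt n) = d ^ 2 * N := by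
      rw [ENNReal.ofReal_mul (by positivity), ENNReal.ofReal_pow hδ.le]
    have hdN0 : d ^ 2 * N ≠ 0 := by positivity
    have hdNtop : d ^ 2 * N ≠ ⊤ := by finiteness
    rw [hZ, hdN, hD, hAr, hL, div_eq_mul_inv J', div_eq_mul_inv (B ^ (2 - 1 / p))]
    calc J' * (N * (A ^ (1 / p) * B ^ (2 - 1 / p)))
        = J' * B ^ (2 - 1 / p) * N * A ^ (1 / p) * ((d ^ 2 * N) * (d ^ 2 * N)⁻¹) *
          (A ^ (2 - 1 / p) * (A ^ (2 - 1 / p))⁻¹) := by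
          rw [ENNReal.mul_inv_cancel hdN0 hdNtop, ENNReal.mul_inv_cancel hAr0 hArtop]; ring
      _ = _ := by ring
  have hYZ : Y ^ 2 ≤ 1 + 144 * Y ^ (1 / p) * Z := by
    have hdD0 : d ^ 2 * D ≠ 0 := by positivity
    have hdDtop : d ^ 2 * D ≠ ⊤ := by finiteness
    rw [← ENNReal.mul_le_mul_iff_left hdD0 hdDtop]
    calc Y ^ 2 * (d ^ 2 * D) = T ^ 2 * D := by rw [← hYd]; ring
      _ ≤ d ^ 2 * D + 144 * Y ^ (1 / p) * (J' * L) := hTD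
      _ = _ := by rw [hZL]; ring
  have hYle := le_of_sq_le_add_rpow hY1 hYtop (by norm_num) hr0.le hr1 hYZ
  have hexp : (2 - 1 / p)⁻¹ = p / (2 * p - 1) := by
    rw [show 2 - 1 / p = (2 * p - 1) / p by field_simp, inv_div]
  rw [hexp] at hYle
  -- the class itself
  have hDhalf : D ^ (1 / 2 : ℝ) = N * A := by
    rw [hD, sq_mul_rpow_half]
    simpa using congrArg (N * ·) (sq_mul_rpow_half A 1)
  have hI1 : ∫⁻ x : Fin n → X, rademacherSup 𝓕 x ∂(Measure.pi fun _ => P) ≤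
      48 * Y * J * (N * A) := by
    refine (lintegral_rademacherSup_le hn h𝓕 hF h2 ht).trans ?_
    rw [← hE2, ← hSdef, hN2, ← hD, hDhalf]
    have h3 : S ^ (1 / 2 : ℝ) / T ≤ N * A := by
      refine ENNReal.div_le_of_le_mul' ?_
      rw [← hDhalf, ← sq_mul_rpow_half]
      gcongr
    calc _ ≤ 12 * (2 * Y * J) * (N * A + N * A) := by
          gcongr
          exact uniformEntropyIntegral_le_two_mul 𝓕 F hδ hδt
      _ = _ := by ring
  calc outerExpectation (Measure.pi fun _ : Fin n => P) (empiricalSup P 𝓕)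
      ≤ N⁻¹ * (2 * (48 * Y * J * (N * A))) := by
        rw [← hNinv]
        refine (h1.outerExpectation_empiricalSup_le hint1 n).trans ?_
        gcongr
    _ = (N * N⁻¹) * (96 * Y * J * A) := by ring
    _ = 96 * Y * J * A := by rw [ENNReal.mul_inv_cancel hN0 hNtop, one_mul]
    -- Here 96 · 144 = 13824.
    _ ≤ 96 * (144 * (1 + Z) ^ (p / (2 * p - 1))) * J * A := by gcongr
    _ = _ := by ring

end EmpProc

end

theorem theorem2 :
    ∃ C : ℝ≥0, ∀ (X : Type u) [MeasurableSpace X] (P : Measure X) [IsProbabilityMeasure P]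
      (𝓕 : Set (X → ℝ)) (F : X → ℝ) (p δ : ℝ) (n : ℕ),
      (∀ f ∈ 𝓕, Measurable f) →
      EmpProc.IsEnvelope F 𝓕 →
      EmpProc.PMeasurable P 𝓕 →
      EmpProc.PMeasurable P (EmpProc.powClass 𝓕 2) →
      EmpProc.PMeasurable P (EmpProc.powClass 𝓕 4) →
      1 < p →
      eLpNorm F (ENNReal.ofReal ((4 * p - 2) / (p - 1))) P < ∞ →
      0 < δ → δ < 1 →
      (∀ f ∈ 𝓕, ∫ x, f x ^ 2 ∂P < δ ^ 2 * ∫ x, F x ^ 2 ∂P) →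
      1 ≤ n →
      EmpProc.outerExpectation (Measure.pi fun _ : Fin n => P) (EmpProc.empiricalSup P 𝓕) ≤
        C * EmpProc.uniformEntropyIntegral δ 𝓕 F 2 *
          (1 + EmpProc.uniformEntropyIntegral (δ ^ (1 / p)) 𝓕 F 2 /
                ENNReal.ofReal (δ ^ 2 * Real.sqrt n) *
              (eLpNorm F (ENNReal.ofReal ((4 * p - 2) / (p - 1))) P ^ (2 - 1 / p) /
                eLpNorm F 2 P ^ (2 - 1 / p))) ^ (p / (2 * p - 1)) *
          eLpNorm F 2 P := by
  refine ⟨13824, ?_⟩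
  intro X _ P _ 𝓕 F p δ n h𝓕 hF h1 h2 _ hp hB hδ _ hvar hn
  -- For the empty class the supremum is 0, and the variance hypothesis no longer forces ‖F‖_{P,2} >
  -- 0.
  rcases 𝓕.eq_empty_or_nonempty with rfl | hne
  · have h0 : EmpProc.outerExpectation (Measure.pi fun _ : Fin n => P)
        (EmpProc.empiricalSup P ∅) ≤ ∫⁻ _x : Fin n → X, 0 ∂(Measure.pi fun _ => P) :=
      iInf_le_of_le _ (iInf_le_of_le measurable_const (iInf_le_of_le
        (fun x => by simp [EmpProc.empiricalSup]) le_rfl))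
    rw [lintegral_zero] at h0
    exact h0.trans zero_le
  · exact_mod_cast EmpProc.outerExpectation_empiricalSup_le hne h𝓕 hF h1 h2 hp hB hδ hvar hn
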